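/- Let $P=(p_{xy})$ be an ergodic (irreducible and aperiodic), reversible Markov chain on a finite state space $X$ with $|X|=n$, with stationary distribution $\pi$. Let $M$ be a set of marked nodes with $\emptyset\neq M\subsetneq X$, and put $p_M=\sum_{x\in M}\pi_x$ and $$|U\rangle=\frac{1}{\sqrt{1-p_M}}\sum_{x\notin M}\sqrt{\pi_x}\,|x\rangle .$$ Let $P'$ be the chain obtained from $P$ by replacing all outgoing edges of the nodes in $M$ by self-loops, and let $P(s)=(1-s)P+sP'=(p_{xy}(s))$. For a chain $Q=(q_{xy})$ let $D(Q)$ be the symmetric matrix with entries $\sqrt{q_{xy}q_{yx}}$. Define the hitting time $$HT(P,M)=\sum_{j=1}^{n-|M|}\frac{|\langle v_j'|U\rangle|^2}{1-\lambda_j'},$$ where $v'_j,\lambda'_j$ ($1\le j\le n-|M|$) are the orthonormal eigenvectors and eigenvalues of $D(P')$ with eigenvalue different from $1$. For $0\le s<1$ let $$HT(s)=\sum_{j=1}^{n-1}\frac{|\langle v_j(s)|U\rangle|^2}{1-\lambda_j(s)},$$ where $v_j(s),\lambda_j(s)$ ($1\le j\le n-1$) are the orthonormal eigenvectors and eigenvalues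 of $D(P(s))$ other than the simple eigenvalue $1$. Then: 1. The extended hitting time $HT^+(P,M)=\lim_{s\to1^-}HT(s)$ exists. 2. If $|M|=1$, then $HT^+(P,M)=HT(P,M)$. 3. Suppose $p_M\le 1/2$, and let $s^*=1-\frac{p_M}{1-p_M}\in[0,1)$. Let $\mathcal H=\mathbb C^X$, let $|0\rangle\in\mathcal H$ be a fixed unit reference vector, and let $V$ be any unitary on $\mathcal H\otimes\mathcal H$ with $V|x,0\rangle=\sum_{y\in X}\sqrt{p_{xy}(s^*)}\,|x,y\rangle$ for all $x\in X$. Let $S|x,y\rangle=|y,x\rangle$ if $p_{xy}(s^*)>0$ and $S|x,y\rangle=|x,y\rangle$ otherwise, let $\Pi_0=I\otimes|0\rangle\langle0|$, and let $H(s^*)=i[V^\dagger SV,\Pi_0]$. Start from $|v_n(0),0\rangle$ with $|v_n(0)\rangle=\sum_{x}\sqrt{\pi_x}\,|x\rangle$, evolve under $H(s^*)$ for a time drawn uniformly at random from $[0,T]$, and measure the first register in the basis $\{|x\rangle\}_{x\in X}$. The expected state before the measurement is $$\bar\rho(T)=\frac1T\int_0^T e^{-iH(s^*)t}\,|v_n(0),0\rangle\langle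 v_n(0),0|\,e^{iH(s^*)t}\,dt .$$ Then for every $\varepsilon>0$ and every $T\ge\frac1\varepsilon\sqrt{\frac{HT^+(P,M)}{2}}$, the expected probability of obtaining a marked node satisfies $$\mathrm{Tr}\big[(\Pi_M\otimes I)\,\bar\rho(T)\big]\ \ge\ \frac14-\varepsilon,\qquad \Pi_M=\sum_{x\in M}|x\rangle\langle x| .$$ -/

import Mathlib

open scoped Matrix Topology

noncomputable section

namespace QSearch

variable {X : Type*} [Fintype X] [DecidableEq X]

/-! ### Markov chains -/

/-- No integer greater than one divides the length of every closed directed walk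
(a closed walk of length `k` through `x` exists iff `0 < (P ^ k) x x`). -/
def IsAperiodic (P : Matrix X X ℝ) : Prop :=
  ¬ ∃ d : ℕ, 1 < d ∧ ∀ (x : X) (k : ℕ), 0 < k → 0 < (P ^ k) x x → d ∣ k

/-- An ergodic Markov chain: a row-stochastic matrix that is irreducible and aperiodic. -/
structure IsErgodicChain (P : Matrix X X ℝ) : Prop where
  stochastic : P ∈ Matrix.rowStochastic ℝ X
  irreducible : P.IsIrreducible
  aperiodic : IsAperiodic P

/-- `π` is a stationary probability distribution of `P`. -/
structure IsStationary (P : Matrix X X ℝ) (π : X → ℝ) : Prop where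
  nonneg : ∀ x, 0 ≤ π x
  sum_eq_one : ∑ x, π x = 1
  vecMul_eq : π ᵥ* P = π

/-- Detailed balance of `P` with respect to `π`. -/
def IsReversible (P : Matrix X X ℝ) (π : X → ℝ) : Prop :=
  ∀ x y, π x * P x y = π y * P y x

/-! ### Interpolated chains -/

/-- The absorbing chain `P'`: all outgoing edges of marked nodes are replaced by self-loops. -/
def absorbing (P : Matrix X X ℝ) (M : Finset X) : Matrix X X ℝ :=
  Matrix.of fun x y => if x ∈ M then (if x = y then 1 else 0) else P x y

/-- The interpolated chain `P(s) = (1 - s) P + s P'`. -/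
def interp (P : Matrix X X ℝ) (M : Finset X) (s : ℝ) : Matrix X X ℝ :=
  (1 - s) • P + s • absorbing P M

/-- `p_M`, the stationary probability of the marked set. -/
def markedMass (π : X → ℝ) (M : Finset X) : ℝ := ∑ x ∈ M, π x

/-- `s* = 1 - p_M / (1 - p_M)`. -/
def sStar (π : X → ℝ) (M : Finset X) : ℝ :=
  1 - markedMass π M / (1 - markedMass π M)

/-! ### Discriminant matrix and hitting times -/

/-- The discriminant matrix `D(Q)`, with entries `√(q_xy q_yx)`. -/
def discriminant (Q : Matrix X X ℝ) : Matrix X X ℝ :=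
  Matrix.of fun x y => √(Q x y * Q y x)

theorem discriminant_isHermitian {X : Type*} (Q : Matrix X X ℝ) :
    (discriminant Q).IsHermitian := by
  ext x y
  simp [discriminant, mul_comm]

/-- The state `|U⟩ = (1 - p_M)^(-1/2) ∑_{x ∉ M} √π_x |x⟩`. -/
def stateU (π : X → ℝ) (M : Finset X) : EuclideanSpace ℝ X :=
  WithLp.toLp 2 fun x => if x ∈ M then 0 else √(π x) / √(1 - markedMass π M)

/-- `∑_j |⟨v_j|u⟩|² / (1 - λ_j)`, summed over an orthonormal eigenbasis `v_j` of `D(Q)` with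
eigenvalues `λ_j`, the eigenvectors of eigenvalue `1` being left out. -/
def resolventSum (Q : Matrix X X ℝ) (u : EuclideanSpace ℝ X) : ℝ :=
  ∑ j with (discriminant_isHermitian Q).eigenvalues j ≠ 1,
    inner ℝ ((discriminant_isHermitian Q).eigenvectorBasis j) u ^ 2 /
      (1 - (discriminant_isHermitian Q).eigenvalues j)

/-- The hitting time `HT(P, M)`. The eigenvalue `1` of `D(P')` has multiplicity `|M|`, so the sum
runs over the remaining `n - |M|` eigenvectors. -/
def hittingTime (P : Matrix X X ℝ) (π : X → ℝ) (M : Finset X) : ℝ :=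
  resolventSum (absorbing P M) (stateU π M)

/-- The interpolated hitting time `HT(s)`. For `0 ≤ s < 1` the eigenvalue `1` of `D(P(s))` is
simple, so the sum runs over the remaining `n - 1` eigenvectors. -/
def interpHittingTime (P : Matrix X X ℝ) (π : X → ℝ) (M : Finset X) (s : ℝ) : ℝ :=
  resolventSum (interp P M s) (stateU π M)

/-- The extended hitting time `HT⁺(P, M) = lim_{s → 1} HT(s)`, with `s < 1`. -/
def extendedHittingTime (P : Matrix X X ℝ) (π : X → ℝ) (M : Finset X) : ℝ :=
  Filter.limUnder (𝓝[<] (1 : ℝ)) (interpHittingTime P π M)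

/-! ### The Somma–Ortiz Hamiltonian on `ℂ^X ⊗ ℂ^X = ℂ^(X × X)` -/

/-- The product state `|φ⟩ ⊗ |χ⟩`. -/
def tensor (φ χ : X → ℂ) : X × X → ℂ := fun a => φ a.1 * χ a.2

/-- `V` is a unitary with `V |x, 0⟩ = ∑_y √q_xy |x, y⟩` for all `x`; `z` is the reference
state `|0⟩` of the second register. -/
def IsWalkUnitary (Q : Matrix X X ℝ) (z : X → ℂ) (V : Matrix (X × X) (X × X) ℂ) : Prop :=
  V ∈ Matrix.unitaryGroup (X × X) ℂ ∧
    ∀ x : X, V *ᵥ tensor (Pi.single x 1) z =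
      ∑ y : X, (√(Q x y) : ℂ) • tensor (Pi.single x 1) (Pi.single y 1)

/-- The operator `S`: `|x, y⟩ ↦ |y, x⟩` if `(x, y)` is an edge of `Q`, and
`|x, y⟩ ↦ |x, y⟩` otherwise. The column of index `b` is the image of `|b⟩`. -/
def swapOp (Q : Matrix X X ℝ) : Matrix (X × X) (X × X) ℂ :=
  Matrix.of fun a b =>
    if 0 < Q b.1 b.2 then (if a = b.swap then 1 else 0) else (if a = b then 1 else 0)

/-- The projector `Π₀ = I ⊗ |0⟩⟨0|`. -/
def projZero (z : X → ℂ) : Matrix (X × X) (X × X) ℂ :=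
  Matrix.kronecker (1 : Matrix X X ℂ) (Matrix.vecMulVec z (star z))

/-- The Hamiltonian `H = i [V† S V, Π₀]` of the chain `Q`. -/
def hamiltonian (Q : Matrix X X ℝ) (z : X → ℂ) (V : Matrix (X × X) (X × X) ℂ) :
    Matrix (X × X) (X × X) ℂ :=
  Complex.I • ⁅Vᴴ * swapOp Q * V, projZero z⁆

/-! ### Randomized evolution and measurement -/

/-- The initial state `|v_n(0), 0⟩`, where `|v_n(0)⟩ = ∑_x √π_x |x⟩`. -/
def initialState (π : X → ℝ) (z : X → ℂ) : X × X → ℂ :=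
  tensor (fun x => (√(π x) : ℂ)) z

/-- The density matrix `e^{-iHt} |ψ⟩⟨ψ| e^{iHt}`. -/
def evolved (H : Matrix (X × X) (X × X) ℂ) (ψ : X × X → ℂ) (t : ℝ) :
    Matrix (X × X) (X × X) ℂ :=
  NormedSpace.exp ((-(Complex.I * t)) • H) * Matrix.vecMulVec ψ (star ψ) *
    NormedSpace.exp ((Complex.I * t) • H)

/-- The expected state `ρ̄(T) = (1/T) ∫₀ᵀ e^{-iHt} |ψ⟩⟨ψ| e^{iHt} dt` after evolving for a time
uniform in `[0, T]`; the integral of a matrix is taken entrywise. -/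
def averaged (H : Matrix (X × X) (X × X) ℂ) (ψ : X × X → ℂ) (T : ℝ) :
    Matrix (X × X) (X × X) ℂ :=
  Matrix.of fun a b => (1 / (T : ℂ)) * ∫ t in (0 : ℝ)..T, evolved H ψ t a b

/-- `Π_M ⊗ I` with `Π_M = ∑_{x ∈ M} |x⟩⟨x|`. -/
def projMarked (M : Finset X) : Matrix (X × X) (X × X) ℂ :=
  Matrix.kronecker (∑ x ∈ M, Matrix.single x x (1 : ℂ)) (1 : Matrix X X ℂ)

/-- The probability `Tr[(Π_M ⊗ I) ρ]` (a real number for a density matrix `ρ`) that measuring the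
first register of `ρ` gives a marked node. -/
def markedProb (M : Finset X) (ρ : Matrix (X × X) (X × X) ℂ) : ℝ :=
  (Matrix.trace (projMarked M * ρ)).re

end QSearch

end

/-!
Write `D = D(P(s))`, `p = p_M`. The chain `P(s)` is reversible for the weights `π` on `M` and
`(1 - s) π` off `M`, so conjugation by the square roots of the weights turns `D` into `P(s)`
(`discriminant_mulVec_sqrt`), and inverting `1 - D` amounts to solving Poisson's equation for
`P(s)`. On `M` the operator `1 - P(s)` is `(1 - s) (1 - P)`, and off `M` it is `1 - P`; up to a
scalar depending on `s` the solution `g` of `g - P g = 1_{X ∖ M} - (1 - p)` therefore serves every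
`s < 1`. This gives the closed form
`HT(s) = ⟨1_{X ∖ M} - (1 - p), g⟩_π / ((1 - p) (1 - s (1 - p))²)` (`interpHittingTime_eq`), from
which the limit `s → 1` can be read off. For a single marked node, `g` can be shifted to vanish on
`M`; it then also inverts `1 - D(P')` at `U` (`hittingTime_eq`). At `s*` the closed form gives
`HT⁺ = 4 HT(s*)`.

For the search algorithm let `B = V† S V` and `G = -i H = [B, Π₀]`. Since `B² = 1` and `B` compresses
to `D` on the range of `Π₀`, a vector `|φ, 0⟩` with `D φ = l φ` satisfies
`G² |φ, 0⟩ = -(1 - l²) |φ, 0⟩`, so it rotates with frequency `√(1 - l²)` and its amplitude in the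
range of `Π₀` is a cosine (`star_tensor_dotProduct_exp_mulVec`). At `s*` the stationary state of
`P(s*)` is `v = (U + W) / √2` with `W` the normalized restriction of `√π` to `M`; put
`u = (U - W) / √2`, so that the initial state is `α v + β u` with `α² ≥ 1/2`. The state
`|v, 0⟩` does not move and has half of its weight on marked nodes, which yields
`α² / 2 ≥ 1/4`, and the cross term is
`-αβ ∑ d_j² cos (√(1 - l_j²) t)` with `d_j = ⟨v_j, u⟩` (`le_markedProb_evolved`). Its time average is
at most `αβ / T` times
`∑ d_j² / √(1 - l_j²) ≤ √(∑ d_j² / (1 - l_j)) √(∑ d_j² / (1 + l_j))`.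
The sum with `1 - l_j` is `2 HT(s*)`. Eigenvalues near `-1` are harmless because the
self-loops on `M` give `1 + D ≥ 2 s* Π_M` (`discriminant_interp_bounds`), which bounds the other
sum by `1 / s*` (`sum_sq_div_one_add_le`); this is compensated by the factor
`αβ = (1 - 2 p) / 2 = s* (1 - p) / 2`, which vanishes if `s* = 0`.
-/

open scoped Matrix Topology

noncomputable section

namespace QSearch

variable {X : Type*} [Fintype X] [DecidableEq X]

/-! ### Ergodic chains -/

theorem IsStationary.vecMul_pow {P : Matrix X X ℝ} {π : X → ℝ} (hπ : IsStationary P π) (k : ℕ) :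
    π ᵥ* P ^ k = π := by
  induction k with
  | zero => simp
  | succ k ih => rw [pow_succ, ← Matrix.vecMul_vecMul, ih, hπ.vecMul_eq]

theorem IsStationary.pos {P : Matrix X X ℝ} {π : X → ℝ} (hP : IsErgodicChain P)
    (hπ : IsStationary P π) (y : X) : 0 < π y := by
  obtain ⟨x, hx⟩ : ∃ x, 0 < π x := by
    by_contra! h
    have h0 : ∑ x, π x ≤ 0 := Finset.sum_nonpos fun x _ => h x
    linarith [hπ.sum_eq_one]
  obtain ⟨k, -, hk⟩ :=
    (Matrix.isIrreducible_iff_exists_pow_pos hP.irreducible.nonneg).1 hP.irreducible x y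
  have hst := pow_mem hP.stochastic k
  rw [← hπ.vecMul_pow k]
  exact (mul_pos hx hk).trans_le
    (Finset.single_le_sum (f := fun i => π i * (P ^ k) i y)
      (fun i _ => mul_nonneg (hπ.nonneg i) (hst.1 i y)) (Finset.mem_univ x))

/-- The maximum principle: a function harmonic for an ergodic chain is constant. -/
theorem IsErgodicChain.harmonic_const {P : Matrix X X ℝ} (hP : IsErgodicChain P) {h : X → ℝ}
    (hh : P *ᵥ h = h) (x y : X) : h x = h y := by
  have hpow : ∀ k : ℕ, P ^ k *ᵥ h = h := by
    intro k
    induction k with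
    | zero => simp
    | succ k ih => rw [pow_succ, ← Matrix.mulVec_mulVec, hh, ih]
  obtain ⟨m, -, hm⟩ := Finset.exists_max_image Finset.univ h ⟨x, Finset.mem_univ x⟩
  have key : ∀ z, h z = h m := by
    intro z
    obtain ⟨k, -, hk⟩ :=
      (Matrix.isIrreducible_iff_exists_pow_pos hP.irreducible.nonneg).1 hP.irreducible m z
    have hst := pow_mem hP.stochastic k
    have h0 : ∑ i, (P ^ k) m i * (h m - h i) = 0 := by
      have h1 : ∑ i, (P ^ k) m i * h i = h m := congrFun (hpow k) m
      simp_rw [mul_sub, Finset.sum_sub_distrib, ← Finset.sum_mul,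
        Matrix.sum_row_of_mem_rowStochastic hst m, h1]
      ring
    have h2 := (Finset.sum_eq_zero_iff_of_nonneg fun i hi =>
      mul_nonneg (hst.1 m i) (sub_nonneg.2 (hm i hi))).1 h0 z (Finset.mem_univ z)
    rcases mul_eq_zero.1 h2 with h3 | h3 <;> linarith
  rw [key x, key y]

/-- Poisson's equation `g - P g = c` is solvable whenever `c` has stationary mean zero. -/
theorem IsErgodicChain.exists_poisson {P : Matrix X X ℝ} {π : X → ℝ} (hP : IsErgodicChain P)
    (hπ : IsStationary P π) {c : X → ℝ} (hc : π ⬝ᵥ c = 0) : ∃ g : X → ℝ, g - P *ᵥ g = c := by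
  classical
  let L : (X → ℝ) →ₗ[ℝ] (X → ℝ) := LinearMap.id - P.mulVecLin
  let φ : (X → ℝ) →ₗ[ℝ] ℝ := dotProductBilin ℝ ℝ π
  have hφ : ∀ f, φ f = π ⬝ᵥ f := fun f => rfl
  have hle : LinearMap.range L ≤ LinearMap.ker φ := by
    rintro _ ⟨f, rfl⟩
    rw [LinearMap.mem_ker, hφ]
    simp [L, dotProduct_sub, Matrix.dotProduct_mulVec, hπ.vecMul_eq]
  have hker : LinearMap.ker L ≤ Submodule.span ℝ {(1 : X → ℝ)} := by
    intro f hf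
    have hf' : P *ᵥ f = f := by
      have : f - P *ᵥ f = 0 := hf
      exact (sub_eq_zero.1 this).symm
    rw [Submodule.mem_span_singleton]
    rcases isEmpty_or_nonempty X with hX | ⟨⟨x⟩⟩
    · exact ⟨0, Subsingleton.elim _ _⟩
    · exact ⟨f x, by ext y; simp [hP.harmonic_const hf' x y]⟩
  have hφ1 : φ 1 = 1 := by rw [hφ, dotProduct_one, hπ.sum_eq_one]
  have hsurj : LinearMap.range φ = ⊤ := by
    rw [LinearMap.range_eq_top]
    intro t
    exact ⟨t • 1, by rw [map_smul, hφ1, smul_eq_mul, mul_one]⟩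
  have e1 := LinearMap.finrank_range_add_finrank_ker L
  have e2 := LinearMap.finrank_range_add_finrank_ker φ
  rw [hsurj, finrank_top, Module.finrank_self] at e2
  have e3 := (Submodule.finrank_mono hker).trans (finrank_span_le_card (R := ℝ) {(1 : X → ℝ)})
  rw [Set.toFinset_singleton, Finset.card_singleton] at e3
  have heq := Submodule.eq_of_le_of_finrank_le hle (by omega)
  have hcm : c ∈ LinearMap.range L := by rw [heq, LinearMap.mem_ker, hφ, hc]
  exact hcm

/-! ### Eigenbases of real symmetric matrices -/

section Eigenbasis

variable {A : Matrix X X ℝ} (hA : A.IsHermitian)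

theorem inner_eq_dotProduct {X : Type*} [Fintype X] (a b : EuclideanSpace ℝ X) :
    inner ℝ a b = a.ofLp ⬝ᵥ b.ofLp := by
  rw [EuclideanSpace.inner_eq_star_dotProduct, star_trivial, dotProduct_comm]

theorem eigenvectorBasis_dotProduct_mulVec (j : X) (w : X → ℝ) :
    (hA.eigenvectorBasis j).ofLp ⬝ᵥ (A *ᵥ w) =
      hA.eigenvalues j * ((hA.eigenvectorBasis j).ofLp ⬝ᵥ w) := by
  have hT : Aᵀ = A := by
    rw [← Matrix.conjTranspose_eq_transpose_of_trivial]
    exact hA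
  rw [Matrix.dotProduct_mulVec, ← Matrix.mulVec_transpose, hT, hA.mulVec_eigenvectorBasis,
    smul_dotProduct, smul_eq_mul]

theorem sum_eigenvectorBasis_mul (a b : X → ℝ) :
    ∑ j, ((hA.eigenvectorBasis j).ofLp ⬝ᵥ a) * ((hA.eigenvectorBasis j).ofLp ⬝ᵥ b) =
      a ⬝ᵥ b := by
  have h := hA.eigenvectorBasis.sum_inner_mul_inner (WithLp.toLp 2 a) (WithLp.toLp 2 b)
  simp only [inner_eq_dotProduct] at h
  rw [← h]
  exact Finset.sum_congr rfl fun j _ => by rw [dotProduct_comm a]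

theorem sum_eigenvectorBasis_smul (a : X → ℝ) :
    ∑ j, ((hA.eigenvectorBasis j).ofLp ⬝ᵥ a) • (hA.eigenvectorBasis j).ofLp = a := by
  have h := hA.eigenvectorBasis.sum_repr' (WithLp.toLp 2 a)
  simp only [inner_eq_dotProduct] at h
  have h2 := congrArg WithLp.ofLp h
  simpa using h2

theorem eigenvectorBasis_dotProduct_self (j : X) :
    (hA.eigenvectorBasis j).ofLp ⬝ᵥ (hA.eigenvectorBasis j).ofLp = 1 := by
  rw [← inner_eq_dotProduct, real_inner_self_eq_norm_sq, hA.eigenvectorBasis.orthonormal.1 j,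
    one_pow]

end Eigenbasis

/-- If `u = r + (1 - D(Q)) w` with `D(Q) r = r`, then `w` inverts `1 - D(Q)` on the part of `u`
that the sum sees, and the sum is the quadratic form of `1 - D(Q)` at `w`. -/
theorem resolventSum_eq (Q : Matrix X X ℝ) (u : EuclideanSpace ℝ X) {r w : X → ℝ}
    (hr : discriminant Q *ᵥ r = r) (hu : u.ofLp = r + (w - discriminant Q *ᵥ w)) :
    resolventSum Q u = (w - discriminant Q *ᵥ w) ⬝ᵥ w := by
  have hA := discriminant_isHermitian Q
  rw [resolventSum, ← sum_eigenvectorBasis_mul hA, Finset.sum_filter]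
  refine Finset.sum_congr rfl fun j _ => ?_
  have h1 := eigenvectorBasis_dotProduct_mulVec hA j r
  have h2 := eigenvectorBasis_dotProduct_mulVec hA j w
  rw [hr] at h1
  rw [inner_eq_dotProduct, hu, dotProduct_add, dotProduct_sub, h2]
  split_ifs with hj
  · have hj' : 1 - hA.eigenvalues j ≠ 0 := sub_ne_zero.2 (Ne.symm hj)
    have h3 : (hA.eigenvectorBasis j).ofLp ⬝ᵥ r = 0 := by
      have : (1 - hA.eigenvalues j) * ((hA.eigenvectorBasis j).ofLp ⬝ᵥ r) = 0 := by linarith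
      exact (mul_eq_zero.1 this).resolve_left hj'
    rw [h3]
    field_simp
    ring
  · have hj' : hA.eigenvalues j = 1 := by simpa using hj
    rw [hj']
    ring

/-! ### Interpolated chains -/

/-- For a chain reversible with respect to the positive weights `r`, the discriminant matrix is
conjugate to the chain by the diagonal matrix of the `√r`. -/
theorem discriminant_mulVec_sqrt {X : Type*} [Fintype X] {Q : Matrix X X ℝ} {r : X → ℝ}
    (hr : ∀ x, 0 < r x)
    (hQ : ∀ x y, 0 ≤ Q x y) (hrev : IsReversible Q r) (f : X → ℝ) :
    discriminant Q *ᵥ (fun x => √(r x) * f x) = fun x => √(r x) * (Q *ᵥ f) x := by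
  ext x
  simp only [Matrix.mulVec, dotProduct, Finset.mul_sum, discriminant, Matrix.of_apply]
  refine Finset.sum_congr rfl fun y _ => ?_
  have h : √(Q x y * Q y x) * √(r y) = √(r x) * Q x y := by
    rw [← Real.sqrt_mul (mul_nonneg (hQ x y) (hQ y x)), mul_assoc, mul_comm (Q y x),
      ← hrev x y, show Q x y * (r x * Q x y) = r x * Q x y ^ 2 by ring,
      Real.sqrt_mul (hr x).le, Real.sqrt_sq (hQ x y)]
  rw [← mul_assoc, h, mul_assoc]

/-- The (unnormalized) stationary weights of `P(s)`: those of `P`, scaled by `1 - s` outside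
`M`. -/
def interpWeight (π : X → ℝ) (M : Finset X) (s : ℝ) (x : X) : ℝ :=
  if x ∈ M then π x else (1 - s) * π x

theorem interp_apply {X : Type*} [DecidableEq X] (P : Matrix X X ℝ) (M : Finset X) (s : ℝ) (x y : X) :
    interp P M s x y =
      if x ∈ M then (1 - s) * P x y + (if x = y then s else 0) else P x y := by
  simp only [interp, absorbing, Matrix.add_apply, Matrix.smul_apply, Matrix.of_apply, smul_eq_mul]
  split_ifs <;> ring

theorem interp_mulVec (P : Matrix X X ℝ) (M : Finset X) (s : ℝ) (f : X → ℝ) (x : X) :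
    (interp P M s *ᵥ f) x = if x ∈ M then (1 - s) * (P *ᵥ f) x + s * f x else (P *ᵥ f) x := by
  simp only [Matrix.mulVec, dotProduct, interp_apply]
  split_ifs
  · simp [add_mul, Finset.sum_add_distrib, Finset.mul_sum, mul_assoc]
  · rfl

theorem interp_nonneg {X : Type*} [DecidableEq X] {P : Matrix X X ℝ}
    (hP : ∀ x y, 0 ≤ P x y) (M : Finset X) {s : ℝ}
    (h0 : 0 ≤ s) (h1 : s < 1) (x y : X) : 0 ≤ interp P M s x y := by
  have := hP x y
  have h2 : 0 ≤ (1 - s) * P x y := mul_nonneg (by linarith) this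
  rw [interp_apply]
  split_ifs <;> linarith

theorem interp_mulVec_one {P : Matrix X X ℝ} (hP : P *ᵥ 1 = 1) (M : Finset X) (s : ℝ) :
    interp P M s *ᵥ 1 = 1 := by
  ext x
  rw [interp_mulVec, hP]
  split_ifs <;> simp

theorem interp_reversible {X : Type*} [DecidableEq X] {P : Matrix X X ℝ} {π : X → ℝ}
    (hrev : IsReversible P π)
    (M : Finset X) (s : ℝ) : IsReversible (interp P M s) (interpWeight π M s) := by
  intro x y
  have h := hrev x y
  by_cases hxy : x = y
  · rw [hxy]
  · rw [interp_apply, interp_apply, interpWeight, interpWeight, if_neg hxy, if_neg (Ne.symm hxy)]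
    split_ifs
    · linear_combination (1 - s) * h
    · linear_combination (1 - s) * h
    · linear_combination (1 - s) * h
    · linear_combination (1 - s) * h

theorem interpWeight_pos {X : Type*} [DecidableEq X] {π : X → ℝ}
    (hπ : ∀ x, 0 < π x) (M : Finset X) {s : ℝ} (h1 : s < 1)
    (x : X) : 0 < interpWeight π M s x := by
  have h2 : 0 < (1 - s) * π x := mul_pos (by linarith) (hπ x)
  unfold interpWeight
  split_ifs
  · exact hπ x
  · exact h2

/-! ### The hitting time as a quadratic form -/

/-- The source term of Poisson's equation: `1 - p_M` times the uniform constant is subtracted from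
the indicator of the unmarked nodes, which leaves stationary mean zero. -/
def hitSource (π : X → ℝ) (M : Finset X) (x : X) : ℝ :=
  if x ∈ M then -(1 - markedMass π M) else markedMass π M

theorem sum_ite_mul_eq (π : X → ℝ) (M : Finset X) (hsum : ∑ x, π x = 1) (a b : ℝ) :
    ∑ x, π x * (if x ∈ M then a else b) = markedMass π M * a + (1 - markedMass π M) * b := by
  have h : ∀ x, π x * (if x ∈ M then a else b) = (if x ∈ M then π x else 0) * (a - b) + π x * b := by
    intro x
    split_ifs <;> ring
  simp_rw [h, Finset.sum_add_distrib, ← Finset.sum_mul, hsum, markedMass]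
  rw [Finset.sum_ite_mem, Finset.univ_inter]
  ring

theorem dotProduct_hitSource {π : X → ℝ} (M : Finset X) (hsum : ∑ x, π x = 1) :
    π ⬝ᵥ hitSource π M = 0 := by
  have h := sum_ite_mul_eq π M hsum (-(1 - markedMass π M)) (markedMass π M)
  simp only [dotProduct, hitSource]
  rw [h]
  ring

theorem markedMass_pos {X : Type*} {π : X → ℝ} (hπ : ∀ x, 0 < π x) {M : Finset X}
    (hM : M.Nonempty) :
    0 < markedMass π M := Finset.sum_pos (fun x _ => hπ x) hM

theorem markedMass_lt_one {π : X → ℝ} (hπ : ∀ x, 0 < π x) (hsum : ∑ x, π x = 1) {M : Finset X}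
    (hM : M ≠ Finset.univ) : markedMass π M < 1 := by
  rw [← hsum]
  obtain ⟨x, hx⟩ : ∃ x, x ∉ M := by
    by_contra! h
    exact hM (Finset.eq_univ_of_forall h)
  exact Finset.sum_lt_sum_of_subset (Finset.subset_univ M) (Finset.mem_univ x) hx (hπ x)
    fun y _ _ => (hπ y).le

/-- The exact dependence of `HT(s)` on `s`: it is inversely proportional to
`(1 - s (1 - p_M))²`. -/
theorem interpHittingTime_eq {P : Matrix X X ℝ} {π : X → ℝ} {M : Finset X} {g : X → ℝ}
    (hP : P ∈ Matrix.rowStochastic ℝ X) (hpos : ∀ x, 0 < π x)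
    (hrev : IsReversible P π) (hM1 : markedMass π M < 1) (hM0 : 0 < markedMass π M)
    (hg : g - P *ᵥ g = hitSource π M) {s : ℝ} (h0 : 0 ≤ s) (h1 : s < 1) :
    interpHittingTime P π M s =
      (∑ x, π x * (hitSource π M x * g x)) /
        ((1 - markedMass π M) * (1 - s * (1 - markedMass π M)) ^ 2) := by
  set p := markedMass π M with hp
  set r := interpWeight π M s with hr
  have hrpos : ∀ x, 0 < r x := interpWeight_pos hpos M h1
  have hs : 0 < 1 - s := by linarith
  have hq : 0 < 1 - p := by linarith
  have hN : 0 < 1 - s * (1 - p) := by nlinarith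
  have hconj := discriminant_mulVec_sqrt hrpos (interp_nonneg hP.1 M h0 h1)
    (interp_reversible hrev M s)
  -- the solution of Poisson's equation for `P(s)` is a multiple of the one for `P`
  set k : ℝ := 1 / (√(1 - s) * √(1 - p) * (1 - s * (1 - p))) with hk
  have hss : √(1 - s) ^ 2 = 1 - s := Real.sq_sqrt hs.le
  have hqq : √(1 - p) ^ 2 = 1 - p := Real.sq_sqrt hq.le
  have hs0 : √(1 - s) ≠ 0 := (Real.sqrt_pos.2 hs).ne'
  have hq0 : √(1 - p) ≠ 0 := (Real.sqrt_pos.2 hq).ne'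
  have hgx : ∀ x, g x - (P *ᵥ g) x = if x ∈ M then -(1 - p) else p := fun x => congrFun hg x
  have hQ : ∀ x, (interp P M s *ᵥ (k • g)) x =
      k * g x - k * (if x ∈ M then -((1 - s) * (1 - p)) else p) := by
    intro x
    have := hgx x
    rw [Matrix.mulVec_smul, Pi.smul_apply, interp_mulVec, smul_eq_mul]
    split_ifs with hx
    · rw [if_pos hx] at this
      linear_combination (-k * (1 - s)) * this
    · rw [if_neg hx] at this
      linear_combination (-k) * this
  have hw : ∀ x, √(r x) * (k * g x) - (discriminant (interp P M s) *ᵥ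
      (fun x => √(r x) * (k • g) x)) x =
        √(r x) * (k * (if x ∈ M then -((1 - s) * (1 - p)) else p)) := by
    intro x
    rw [hconj]
    beta_reduce
    rw [hQ]
    ring
  unfold interpHittingTime
  rw [resolventSum_eq (r := fun x => √(r x) * (k * ((1 - s) * (1 - p))))
    (w := fun x => √(r x) * (k • g) x)]
  · rw [dotProduct, Finset.sum_div]
    refine Finset.sum_congr rfl fun x _ => ?_
    have := hw x
    simp only [Pi.sub_apply, Pi.smul_apply, smul_eq_mul] at this ⊢
    rw [this]
    have hrr : √(r x) * √(r x) = r x := Real.mul_self_sqrt (hrpos x).le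
    have hkk : k ^ 2 * (1 - s) = 1 / ((1 - p) * (1 - s * (1 - p)) ^ 2) := by
      rw [hk]
      field_simp
      rw [hss, hqq]
    have e : π x * (hitSource π M x * g x) / ((1 - p) * (1 - s * (1 - p)) ^ 2) =
        (k ^ 2 * (1 - s)) * (π x * (hitSource π M x * g x)) := by
      rw [hkk]; ring
    rw [e]
    have e2 : √(r x) * (k * (if x ∈ M then -((1 - s) * (1 - p)) else p)) *
      (√(r x) * (k * g x)) = r x * k ^ 2 * (if x ∈ M then -((1 - s) * (1 - p)) else p) * g x := by
      rw [show ∀ a b c d : ℝ, a * (b * c) * (a * (b * d)) = a * a * b ^ 2 * c * d by intros; ring,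
        hrr]
    rw [e2]
    simp only [hr, interpWeight, hitSource, ← hp]
    split_ifs <;> ring
  · have := hconj (fun _ => k * ((1 - s) * (1 - p)))
    rw [this]
    ext x
    have h1 : (fun _ : X => k * ((1 - s) * (1 - p))) = (k * ((1 - s) * (1 - p))) • (1 : X → ℝ) := by
      ext; simp
    rw [h1, Matrix.mulVec_smul, interp_mulVec_one hP.2]
    simp
  · ext x
    have := hw x
    simp only [Pi.add_apply, Pi.sub_apply, Pi.smul_apply, smul_eq_mul] at this ⊢
    rw [this]
    simp only [stateU, hr, interpWeight, ← hp]
    split_ifs with hx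
    · ring
    · have hkN : √(1 - s) * k * (1 - s * (1 - p)) = 1 / √(1 - p) := by
        rw [hk]
        field_simp
      rw [Real.sqrt_mul hs.le, div_eq_mul_one_div, ← hkN]
      ring

theorem discriminant_absorbing_mulVec {X : Type*} [Fintype X] [DecidableEq X] (P : Matrix X X ℝ)
    (M : Finset X) {w : X → ℝ} (hw : ∀ x ∈ M, w x = 0) (x : X) :
    (discriminant (absorbing P M) *ᵥ w) x = if x ∈ M then 0 else (discriminant P *ᵥ w) x := by
  simp only [Matrix.mulVec, dotProduct, discriminant, absorbing, Matrix.of_apply]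
  split_ifs with hx
  · refine Finset.sum_eq_zero fun y _ => ?_
    by_cases hxy : x = y
    · rw [← hxy, hw x hx, mul_zero]
    · rw [if_neg hxy, zero_mul, Real.sqrt_zero, zero_mul]
  · refine Finset.sum_congr rfl fun y _ => ?_
    by_cases hy : y ∈ M
    · rw [hw y hy, mul_zero, mul_zero]
    · rw [if_neg hy]

/-- The hitting time of a single marked node, from a solution of Poisson's equation that vanishes
there. -/
theorem hittingTime_eq {P : Matrix X X ℝ} {π : X → ℝ} {M : Finset X} {g : X → ℝ}
    (hP : P ∈ Matrix.rowStochastic ℝ X) (hpos : ∀ x, 0 < π x)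
    (hrev : IsReversible P π) (hM1 : markedMass π M < 1) (hM0 : 0 < markedMass π M)
    (hg : g - P *ᵥ g = hitSource π M) (hgM : ∀ x ∈ M, g x = 0) :
    hittingTime P π M =
      (∑ x, π x * (hitSource π M x * g x)) / ((1 - markedMass π M) * markedMass π M ^ 2) := by
  set p := markedMass π M with hp
  have hq : 0 < 1 - p := by linarith
  have hqq : √(1 - p) ^ 2 = 1 - p := Real.sq_sqrt hq.le
  have hq0 : √(1 - p) ≠ 0 := (Real.sqrt_pos.2 hq).ne'
  set k : ℝ := 1 / (√(1 - p) * p) with hk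
  have hkp : k * p = 1 / √(1 - p) := by rw [hk]; field_simp
  have hw : ∀ x, √(π x) * (k • g) x - (discriminant (absorbing P M) *ᵥ
      (fun x => √(π x) * (k • g) x)) x = √(π x) * (k * (if x ∈ M then 0 else p)) := by
    intro x
    rw [discriminant_absorbing_mulVec P M
      (fun y hy => by rw [Pi.smul_apply, hgM y hy, smul_zero, mul_zero]),
      discriminant_mulVec_sqrt hpos hP.1 hrev, Matrix.mulVec_smul]
    have h := congrFun hg x
    simp only [Pi.sub_apply, hitSource, Pi.smul_apply, smul_eq_mul] at h ⊢
    split_ifs with hx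
    · rw [hgM x hx]
      ring
    · rw [if_neg hx] at h
      linear_combination √(π x) * k * h
  unfold hittingTime
  rw [resolventSum_eq (r := 0) (w := fun x => √(π x) * (k • g) x)]
  · rw [dotProduct, Finset.sum_div]
    refine Finset.sum_congr rfl fun x _ => ?_
    rw [Pi.sub_apply, hw x, Pi.smul_apply, smul_eq_mul]
    have hrr : √(π x) * √(π x) = π x := Real.mul_self_sqrt (hpos x).le
    rw [show ∀ a b c d : ℝ, a * (b * c) * (a * (b * d)) = a * a * b ^ 2 * c * d by intros; ring,
      hrr]
    simp only [hitSource, ← hp]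
    split_ifs with hx
    · rw [hgM x hx]
      ring
    · have hkk : k ^ 2 = 1 / ((1 - p) * p ^ 2) := by
        rw [hk, div_pow, mul_pow, hqq, one_pow]
      rw [hkk]
      ring
  · exact Matrix.mulVec_zero _
  · ext x
    rw [Pi.add_apply, Pi.sub_apply, hw x]
    simp only [stateU, Pi.zero_apply, ← hp]
    split_ifs with hx
    · ring
    · rw [hkp]
      ring

/-- The limit `s → 1` of the closed form of `HT(s)`. -/
theorem tendsto_interpHittingTime {P : Matrix X X ℝ} {π : X → ℝ} {M : Finset X} {g : X → ℝ}
    (hP : P ∈ Matrix.rowStochastic ℝ X) (hpos : ∀ x, 0 < π x)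
    (hrev : IsReversible P π) (hM1 : markedMass π M < 1) (hM0 : 0 < markedMass π M)
    (hg : g - P *ᵥ g = hitSource π M) :
    Filter.Tendsto (interpHittingTime P π M) (𝓝[<] 1)
      (𝓝 ((∑ x, π x * (hitSource π M x * g x)) /
        ((1 - markedMass π M) * markedMass π M ^ 2))) := by
  set p := markedMass π M with hp
  set C := ∑ x, π x * (hitSource π M x * g x)
  have hcont : ContinuousAt (fun s : ℝ => C / ((1 - p) * (1 - s * (1 - p)) ^ 2)) 1 := by
    refine ContinuousAt.div (by fun_prop) (by fun_prop) ?_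
    have hq : 0 < 1 - p := by linarith
    rw [show (1 : ℝ) - 1 * (1 - p) = p by ring]
    positivity
  have ht : Filter.Tendsto (fun s : ℝ => C / ((1 - p) * (1 - s * (1 - p)) ^ 2)) (𝓝[<] 1)
      (𝓝 (C / ((1 - p) * p ^ 2))) := by
    have h := hcont.tendsto.mono_left (nhdsWithin_le_nhds (s := Set.Iio (1 : ℝ)))
    rwa [show (1 : ℝ) - 1 * (1 - p) = p by ring] at h
  refine ht.congr' ?_
  filter_upwards [Ioo_mem_nhdsLT (zero_lt_one' ℝ)] with s hs
  exact (interpHittingTime_eq hP hpos hrev hM1 hM0 hg hs.1.le hs.2).symm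

/-! ### Rotations generated by an element of a Banach algebra -/

/-- If `G² x = -ω² x` then `exp (t G)` rotates `x` in the plane spanned by `x` and `G x`. The
coefficient of `G x` is `sin (ω t) / ω`, or `t` if `ω = 0`. -/
theorem exists_exp_smul_mul_eq {𝔸 : Type*} [NormedRing 𝔸] [NormedAlgebra ℝ 𝔸] [CompleteSpace 𝔸]
    {G x : 𝔸} {ω : ℝ} (h : G * (G * x) = -(ω ^ 2) • x) (t : ℝ) :
    ∃ c : ℝ, NormedSpace.exp (t • G) * x = Real.cos (ω * t) • x + c • (G * x) := by
  have hlin : ∀ t, HasDerivAt (fun t => ω * t) ω t := fun t => by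
    simpa using (hasDerivAt_id t).const_mul ω
  obtain ⟨s, hs0, hs, hs2⟩ : ∃ s : ℝ → ℝ, s 0 = 0 ∧
      (∀ t, HasDerivAt s (Real.cos (ω * t)) t) ∧ ∀ t, ω ^ 2 * s t = ω * Real.sin (ω * t) := by
    by_cases hω : ω = 0
    · exact ⟨id, rfl, fun t => by simpa [hω] using hasDerivAt_id t, fun t => by simp [hω]⟩
    · refine ⟨fun t => Real.sin (ω * t) / ω, by simp, fun t => ?_, fun t => by field_simp⟩
      exact ((hlin t).sin.div_const ω).congr_deriv (by field_simp)
  refine ⟨s t, ?_⟩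
  have hc : ∀ t, HasDerivAt (fun t => Real.cos (ω * t)) (-(ω * Real.sin (ω * t))) t := by
    intro t
    exact (hlin t).cos.congr_deriv (by ring)
  have hy : ∀ t, HasDerivAt (fun t => Real.cos (ω * t) • x + s t • (G * x))
      (G * (Real.cos (ω * t) • x + s t • (G * x))) t := by
    intro t
    refine (((hc t).smul_const x).add ((hs t).smul_const (G * x))).congr_deriv ?_
    rw [mul_add, mul_smul_comm, mul_smul_comm, h, smul_smul,
      show s t * -(ω ^ 2) = -(ω * Real.sin (ω * t)) by rw [← hs2]; ring, add_comm]
  have hF : ∀ t, HasDerivAt (fun t => NormedSpace.exp (t • (-G)) *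
      (Real.cos (ω * t) • x + s t • (G * x))) 0 t := by
    intro t
    refine ((hasDerivAt_exp_smul_const (𝕂 := ℝ) (-G) t).mul (hy t)).congr_deriv ?_
    simp [mul_assoc]
  have hconst := is_const_of_deriv_eq_zero (fun t => (hF t).differentiableAt)
    (fun t => (hF t).deriv) t 0
  simp only [mul_zero, Real.cos_zero, one_smul, hs0, zero_smul, add_zero,
    NormedSpace.exp_zero, one_mul] at hconst
  have hinv : NormedSpace.exp (t • G) * NormedSpace.exp (t • (-G)) = 1 := by
    let _ : NormedAlgebra ℚ 𝔸 := NormedAlgebra.restrictScalars ℚ ℝ 𝔸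
    rw [← NormedSpace.exp_add_of_commute]
    · simp
    · rw [smul_neg]
      exact (Commute.refl _).neg_right
  conv_lhs => rw [← hconst, ← mul_assoc, hinv, one_mul]

section

attribute [local instance] Matrix.linftyOpNormedRing Matrix.linftyOpNormedAlgebra

theorem exists_exp_smul_mulVec_eq {n : Type*} [Fintype n] [DecidableEq n] {G : Matrix n n ℂ}
    {ψ : n → ℂ} {ω : ℝ} (h : G *ᵥ (G *ᵥ ψ) = -(ω ^ 2) • ψ) (t : ℝ) :
    ∃ c : ℝ, NormedSpace.exp (t • G) *ᵥ ψ = Real.cos (ω * t) • ψ + c • (G *ᵥ ψ) := by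
  rcases isEmpty_or_nonempty n with hn | ⟨⟨i⟩⟩
  · exact ⟨0, Subsingleton.elim _ _⟩
  -- vectors are embedded in the matrix algebra as rank-one matrices
  have hx : ∀ ξ : n → ℂ, Matrix.vecMulVec ξ (Pi.single i 1) *ᵥ Pi.single i (1 : ℂ) = ξ := by
    intro ξ
    ext a
    simp [Matrix.vecMulVec_apply]
  have h' : G * (G * Matrix.vecMulVec ψ (Pi.single i 1)) =
      -(ω ^ 2) • Matrix.vecMulVec ψ (Pi.single i 1) := by
    rw [Matrix.mul_vecMulVec, Matrix.mul_vecMulVec, h, Matrix.smul_vecMulVec]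
  obtain ⟨c, hc⟩ := exists_exp_smul_mul_eq h' t
  refine ⟨c, ?_⟩
  have h2 := congrArg (· *ᵥ Pi.single i (1 : ℂ)) hc
  simp only [Matrix.add_mulVec, Matrix.smul_mulVec, ← Matrix.mulVec_mulVec, hx] at h2
  exact h2

theorem continuous_exp_smul {n : Type*} [Fintype n] [DecidableEq n] (G : Matrix n n ℂ) :
    Continuous fun t : ℝ => NormedSpace.exp (t • G) :=
  (differentiable_exp_smul_const ℝ G).continuous

end

/-! ### The walk operator `V† S V` -/

theorem swapOp_mulVec {Q : Matrix X X ℝ} (hQ : ∀ x y, 0 < Q x y → 0 < Q y x) (ξ : X × X → ℂ)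
    (a : X × X) : (swapOp Q *ᵥ ξ) a = if 0 < Q a.1 a.2 then ξ a.swap else ξ a := by
  rw [Matrix.mulVec, dotProduct]
  split_ifs with ha
  · rw [Finset.sum_eq_single a.swap]
    · simp [swapOp, hQ _ _ ha]
    · intro b _ hb
      have h1 : a ≠ b.swap := fun h => hb (by rw [h, Prod.swap_swap])
      have h2 : ¬ 0 < Q b.1 b.2 → a ≠ b := fun h h' => h (h' ▸ ha)
      simp only [swapOp, Matrix.of_apply]
      split_ifs with h3 h4 <;> simp_all
    · simp
  · rw [Finset.sum_eq_single a]
    · simp [swapOp, ha]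
    · intro b _ hb
      have h2 : 0 < Q b.1 b.2 → a ≠ b.swap := fun h h' => ha (h' ▸ hQ _ _ h)
      simp only [swapOp, Matrix.of_apply]
      split_ifs with h3 h4 h5
      · exact absurd h4 (h2 h3)
      · simp
      · exact absurd h5.symm hb
      · simp
    · simp

theorem swapOp_mul_self {Q : Matrix X X ℝ} (hQ : ∀ x y, 0 < Q x y → 0 < Q y x) :
    swapOp Q * swapOp Q = 1 := by
  refine Matrix.mulVec_injective (funext fun ξ => funext fun a => ?_)
  rw [← Matrix.mulVec_mulVec, swapOp_mulVec hQ, swapOp_mulVec hQ, swapOp_mulVec hQ,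
    Matrix.one_mulVec]
  split_ifs with h1 h2
  · rw [Prod.swap_swap]
  · exact absurd (hQ _ _ h1) h2
  · rfl

theorem swapOp_isHermitian {X : Type*} [DecidableEq X] {Q : Matrix X X ℝ}
    (hQ : ∀ x y, 0 < Q x y → 0 < Q y x) :
    (swapOp Q).IsHermitian := by
  ext a b
  rw [Matrix.conjTranspose_apply]
  simp only [swapOp, Matrix.of_apply]
  by_cases hab : a = b.swap
  · subst hab
    have h : 0 < Q b.swap.1 b.swap.2 ↔ 0 < Q b.1 b.2 := ⟨hQ _ _, hQ _ _⟩
    by_cases hb : 0 < Q b.1 b.2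
    · rw [if_pos hb, if_pos (h.2 hb)]
      simp
    · rw [if_neg hb, if_neg (mt h.1 hb)]
      by_cases hbb : b = b.swap
      · rw [if_pos hbb, if_pos hbb.symm, star_one]
      · rw [if_neg hbb, if_neg (Ne.symm hbb), star_zero]
  · have hba : b ≠ a.swap := fun h => hab (by rw [h, Prod.swap_swap])
    by_cases hbb : a = b
    · subst hbb
      split_ifs <;> simp
    · simp [hab, hba, hbb, Ne.symm hbb]

/-- The operator `V† S V`. -/
def walkOp (Q : Matrix X X ℝ) (V : Matrix (X × X) (X × X) ℂ) : Matrix (X × X) (X × X) ℂ :=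
  Vᴴ * swapOp Q * V

theorem walkOp_mul_self {Q : Matrix X X ℝ} {z : X → ℂ} {V : Matrix (X × X) (X × X) ℂ}
    (hQ : ∀ x y, 0 < Q x y → 0 < Q y x) (hV : IsWalkUnitary Q z V) :
    walkOp Q V * walkOp Q V = 1 := by
  have h1 : V * Vᴴ = 1 := Matrix.mem_unitaryGroup_iff.1 hV.1
  have h2 : Vᴴ * V = 1 := Matrix.mem_unitaryGroup_iff'.1 hV.1
  calc walkOp Q V * walkOp Q V = Vᴴ * (swapOp Q * (V * Vᴴ) * swapOp Q) * V := by
        simp only [walkOp, Matrix.mul_assoc]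
    _ = 1 := by rw [h1, Matrix.mul_one, swapOp_mul_self hQ, Matrix.mul_one, h2]

theorem walkOp_isHermitian {Q : Matrix X X ℝ} (hQ : ∀ x y, 0 < Q x y → 0 < Q y x)
    (V : Matrix (X × X) (X × X) ℂ) : (walkOp Q V).IsHermitian :=
  Matrix.isHermitian_conjTranspose_mul_mul V (swapOp_isHermitian hQ)

theorem IsWalkUnitary.mulVec_tensor {Q : Matrix X X ℝ} {z : X → ℂ}
    {V : Matrix (X × X) (X × X) ℂ} (hV : IsWalkUnitary Q z V) (φ : X → ℂ) :
    V *ᵥ tensor φ z = fun a => φ a.1 * √(Q a.1 a.2) := by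
  have h : tensor φ z = ∑ x, φ x • tensor (Pi.single x 1) z := by
    ext a
    simp [tensor, Finset.sum_apply, Pi.single_apply]
  rw [h, Matrix.mulVec_sum]
  simp_rw [Matrix.mulVec_smul, hV.2]
  ext ⟨a, b⟩
  simp [tensor, Finset.sum_apply, Pi.single_apply]

/-! ### Contraction with the reference state -/

/-- The map `I ⊗ ⟨0|`. -/
def contract {X : Type*} [Fintype X] (z : X → ℂ) (ξ : X × X → ℂ) : X → ℂ :=
  fun x => ∑ y, star (z y) * ξ (x, y)

theorem projZero_mulVec (z : X → ℂ) (ξ : X × X → ℂ) :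
    projZero z *ᵥ ξ = tensor (contract z ξ) z := by
  ext ⟨a, b⟩
  simp [Matrix.mulVec, dotProduct, projZero, tensor, contract, Fintype.sum_prod_type,
    Matrix.kronecker, Matrix.kroneckerMap_apply, Matrix.vecMulVec_apply, Matrix.one_apply,
    Finset.sum_mul, ite_mul]
  refine Finset.sum_congr rfl fun y _ => by ring

theorem star_tensor_dotProduct {X : Type*} [Fintype X] (χ z : X → ℂ) (ξ : X × X → ℂ) :
    star (tensor χ z) ⬝ᵥ ξ = star χ ⬝ᵥ contract z ξ := by
  simp only [dotProduct, Fintype.sum_prod_type, tensor, contract, Pi.star_apply, star_mul',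
    Finset.mul_sum]
  exact Finset.sum_congr rfl fun x _ => Finset.sum_congr rfl fun y _ => by ring

theorem contract_tensor {X : Type*} [Fintype X] {z : X → ℂ} (hz : star z ⬝ᵥ z = 1) (φ : X → ℂ) :
    contract z (tensor φ z) = φ := by
  ext x
  have h : ∑ y, star (z y) * z y = 1 := hz
  calc ∑ y, star (z y) * (φ x * z y) = φ x * ∑ y, star (z y) * z y := by
        rw [Finset.mul_sum]
        exact Finset.sum_congr rfl fun y _ => by ring
    _ = φ x := by rw [h, mul_one]

theorem contract_sub {X : Type*} [Fintype X] (z : X → ℂ) (ξ η : X × X → ℂ) :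
    contract z (ξ - η) = contract z ξ - contract z η := by
  ext x
  simp [contract, mul_sub]

theorem projZero_isHermitian {X : Type*} [DecidableEq X] (z : X → ℂ) : (projZero z).IsHermitian := by
  ext ⟨a, b⟩ ⟨c, d⟩
  simp [projZero, Matrix.kronecker, Matrix.kroneckerMap_apply, Matrix.vecMulVec_apply,
    Matrix.conjTranspose_apply, Matrix.one_apply, eq_comm]
  split_ifs <;> simp_all [mul_comm]

/-- `V† S V` acts on the reference subspace as the discriminant matrix. -/
theorem contract_walkOp_mulVec {Q : Matrix X X ℝ} {z : X → ℂ} {V : Matrix (X × X) (X × X) ℂ}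
    (hQ : ∀ x y, 0 < Q x y → 0 < Q y x) (hQ0 : ∀ x y, 0 ≤ Q x y) (hV : IsWalkUnitary Q z V)
    (φ : X → ℂ) :
    contract z (walkOp Q V *ᵥ tensor φ z) = (discriminant Q).map Complex.ofReal *ᵥ φ := by
  have key : ∀ χ : X → ℂ, star χ ⬝ᵥ contract z (walkOp Q V *ᵥ tensor φ z) =
      star χ ⬝ᵥ ((discriminant Q).map Complex.ofReal *ᵥ φ) := by
    intro χ
    rw [← star_tensor_dotProduct, walkOp, ← Matrix.mulVec_mulVec, ← Matrix.mulVec_mulVec,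
      Matrix.dotProduct_mulVec, ← Matrix.star_mulVec, hV.mulVec_tensor, hV.mulVec_tensor]
    simp only [dotProduct, Fintype.sum_prod_type, swapOp_mulVec hQ]
    refine Finset.sum_congr rfl fun x _ => ?_
    rw [Matrix.mulVec, dotProduct, Finset.mul_sum]
    refine Finset.sum_congr rfl fun y _ => ?_
    simp only [Pi.star_apply, star_mul', Prod.swap_prod_mk, Matrix.map_apply, discriminant,
      Matrix.of_apply, RCLike.star_def, Complex.conj_ofReal, Real.sqrt_mul (hQ0 x y),
      Complex.ofReal_mul]
    split_ifs with h1
    · ring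
    · have h0 : Q x y = 0 := le_antisymm (not_lt.1 h1) (hQ0 x y)
      simp [h0]
  ext x
  have h := key (Pi.single x 1)
  simpa [Pi.star_single] using h

/-! ### Evolution of eigenstates -/

section Evolution

variable {Q : Matrix X X ℝ} {z : X → ℂ} {V : Matrix (X × X) (X × X) ℂ}

/-- The generator `-i H = [V† S V, Π₀]` of the evolution. -/
def generator (Q : Matrix X X ℝ) (z : X → ℂ) (V : Matrix (X × X) (X × X) ℂ) :
    Matrix (X × X) (X × X) ℂ := ⁅walkOp Q V, projZero z⁆

theorem generator_conjTranspose (hQ : ∀ x y, 0 < Q x y → 0 < Q y x) :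
    (generator Q z V)ᴴ = -generator Q z V := by
  rw [generator, Ring.lie_def, Matrix.conjTranspose_sub, Matrix.conjTranspose_mul,
    Matrix.conjTranspose_mul, (walkOp_isHermitian hQ V).eq, (projZero_isHermitian z).eq, neg_sub]

theorem generator_mulVec (ξ : X × X → ℂ) : generator Q z V *ᵥ ξ =
    walkOp Q V *ᵥ tensor (contract z ξ) z - tensor (contract z (walkOp Q V *ᵥ ξ)) z := by
  rw [generator, Ring.lie_def, Matrix.sub_mulVec, ← Matrix.mulVec_mulVec, ← Matrix.mulVec_mulVec,
    projZero_mulVec, projZero_mulVec]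

theorem tensor_smul {X : Type*} (c : ℂ) (φ z : X → ℂ) : tensor (c • φ) z = c • tensor φ z := by
  ext a
  simp [tensor, mul_assoc]

theorem map_mulVec_of_real {X : Type*} [Fintype X] {A : Matrix X X ℝ} {φ : X → ℝ} {l : ℝ}
    (h : A *ᵥ φ = l • φ) :
    A.map Complex.ofReal *ᵥ (fun x => (φ x : ℂ)) = (l : ℂ) • fun x => (φ x : ℂ) := by
  ext x
  have h1 := congrArg Complex.ofReal (congrFun h x)
  simpa [Matrix.mulVec, dotProduct] using h1

variable (hQ : ∀ x y, 0 < Q x y → 0 < Q y x) (hQ0 : ∀ x y, 0 ≤ Q x y)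
  (hz : star z ⬝ᵥ z = 1) (hV : IsWalkUnitary Q z V)

include hQ hQ0 hz hV

/-- On `|φ, 0⟩` with `D(Q) φ = l φ` the generator is `V† S V - l`. -/
theorem generator_mulVec_eigen {φ : X → ℝ} {l : ℝ} (hφ : discriminant Q *ᵥ φ = l • φ) :
    generator Q z V *ᵥ tensor (fun x => (φ x : ℂ)) z =
      walkOp Q V *ᵥ tensor (fun x => (φ x : ℂ)) z - (l : ℂ) • tensor (fun x => (φ x : ℂ)) z := by
  rw [generator_mulVec, contract_tensor hz, contract_walkOp_mulVec hQ hQ0 hV,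
    map_mulVec_of_real hφ, tensor_smul]

theorem contract_generator_mulVec_eigen {φ : X → ℝ} {l : ℝ}
    (hφ : discriminant Q *ᵥ φ = l • φ) :
    contract z (generator Q z V *ᵥ tensor (fun x => (φ x : ℂ)) z) = 0 := by
  rw [generator_mulVec_eigen hQ hQ0 hz hV hφ, contract_sub, ← tensor_smul, contract_tensor hz,
    contract_walkOp_mulVec hQ hQ0 hV, map_mulVec_of_real hφ, sub_self]

theorem generator_sq_mulVec_eigen {φ : X → ℝ} {l : ℝ} (hl : l ^ 2 ≤ 1)
    (hφ : discriminant Q *ᵥ φ = l • φ) :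
    generator Q z V *ᵥ (generator Q z V *ᵥ tensor (fun x => (φ x : ℂ)) z) =
      -(√(1 - l ^ 2) ^ 2) • tensor (fun x => (φ x : ℂ)) z := by
  have h0 : tensor (0 : X → ℂ) z = 0 := by ext a; simp [tensor]
  have hB : walkOp Q V *ᵥ (walkOp Q V *ᵥ tensor (fun x => (φ x : ℂ)) z) =
      tensor (fun x => (φ x : ℂ)) z := by
    rw [Matrix.mulVec_mulVec, walkOp_mul_self hQ hV, Matrix.one_mulVec]
  rw [generator_mulVec, contract_generator_mulVec_eigen hQ hQ0 hz hV hφ, h0, Matrix.mulVec_zero,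
    generator_mulVec_eigen hQ hQ0 hz hV hφ, Matrix.mulVec_sub, hB, Matrix.mulVec_smul,
    contract_sub, contract_tensor hz, ← Matrix.mulVec_smul, ← tensor_smul, contract_walkOp_mulVec hQ hQ0 hV,
    Matrix.mulVec_smul, map_mulVec_of_real hφ, Real.sq_sqrt (by linarith)]
  ext a
  simp [tensor]
  ring

/-- The return amplitude to the reference subspace of an eigenstate of `D(Q)` oscillates with
frequency `√(1 - l²)`. -/
theorem star_tensor_dotProduct_exp_mulVec {φ : X → ℝ} {l : ℝ} (hl : l ^ 2 ≤ 1)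
    (hφ : discriminant Q *ᵥ φ = l • φ) (χ : X → ℂ) (t : ℝ) :
    star (tensor χ z) ⬝ᵥ (NormedSpace.exp (t • generator Q z V) *ᵥ
      tensor (fun x => (φ x : ℂ)) z) =
      Real.cos (√(1 - l ^ 2) * t) * (star χ ⬝ᵥ fun x => (φ x : ℂ)) := by
  obtain ⟨c, hc⟩ :=
    exists_exp_smul_mulVec_eq (generator_sq_mulVec_eigen hQ hQ0 hz hV hl hφ) t
  rw [hc, dotProduct_add, dotProduct_smul, dotProduct_smul, star_tensor_dotProduct,
    star_tensor_dotProduct, contract_generator_mulVec_eigen hQ hQ0 hz hV hφ, contract_tensor hz,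
    dotProduct_zero, smul_zero, add_zero, Complex.real_smul]

open scoped ComplexOrder in
/-- Fixed vectors of `D(Q)` give stationary states. -/
theorem exp_mulVec_tensor_of_fixed {φ : X → ℝ} (hφ : discriminant Q *ᵥ φ = φ) (t : ℝ) :
    NormedSpace.exp (t • generator Q z V) *ᵥ tensor (fun x => (φ x : ℂ)) z =
      tensor (fun x => (φ x : ℂ)) z := by
  have hφ' : discriminant Q *ᵥ φ = (1 : ℝ) • φ := by rw [hφ, one_smul]
  have h2 := generator_sq_mulVec_eigen hQ hQ0 hz hV (by norm_num) hφ'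
  -- the generator is anti-Hermitian, so its square vanishes on a vector only if it does
  have h1 : generator Q z V *ᵥ tensor (fun x => (φ x : ℂ)) z = 0 := by
    rw [← dotProduct_star_self_eq_zero, Matrix.star_mulVec,
      ← Matrix.dotProduct_mulVec, generator_conjTranspose hQ, Matrix.neg_mulVec, h2]
    simp
  obtain ⟨c, hc⟩ := exists_exp_smul_mulVec_eq h2 t
  rw [hc, h1]
  simp

end Evolution

/-! ### Measurement statistics -/

theorem markedProb_eq (M : Finset X) (ρ : Matrix (X × X) (X × X) ℂ) :
    markedProb M ρ = ∑ a : X × X, if a.1 ∈ M then (ρ a a).re else 0 := by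
  have h : ∀ a, (projMarked M * ρ) a a = if a.1 ∈ M then ρ a a else 0 := by
    rintro ⟨x, y⟩
    simp only [Matrix.mul_apply, projMarked, Matrix.kronecker, Matrix.kroneckerMap_apply,
      Fintype.sum_prod_type, Matrix.one_apply, Matrix.sum_apply, Matrix.single_apply]
    rw [Finset.sum_eq_single x, Finset.sum_eq_single y]
    · by_cases hx : x ∈ M <;> simp [hx]
    · intro b _ hb
      simp [Ne.symm hb]
    · simp
    · intro b _ hb
      refine Finset.sum_eq_zero fun c _ => ?_
      rw [Finset.sum_eq_zero, zero_mul, zero_mul]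
      intro d _
      rw [if_neg]
      rintro ⟨rfl, rfl⟩
      exact hb rfl
    · simp
  rw [markedProb, Matrix.trace, Complex.re_sum]
  refine Finset.sum_congr rfl fun a _ => ?_
  rw [Matrix.diag_apply, h]
  split_ifs <;> simp

theorem evolved_hamiltonian {Q : Matrix X X ℝ} {z : X → ℂ} {V : Matrix (X × X) (X × X) ℂ}
    (hQ : ∀ x y, 0 < Q x y → 0 < Q y x) (ψ : X × X → ℂ) (t : ℝ) :
    evolved (hamiltonian Q z V) ψ t =
      Matrix.vecMulVec (NormedSpace.exp (t • generator Q z V) *ᵥ ψ)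
        (star (NormedSpace.exp (t • generator Q z V) *ᵥ ψ)) := by
  have h1 : (-(Complex.I * t)) • hamiltonian Q z V = t • generator Q z V := by
    rw [hamiltonian, smul_smul, show -(Complex.I * t) * Complex.I = (t : ℂ) by
      linear_combination (-(t : ℂ)) * Complex.I_mul_I]
    exact Complex.coe_smul t _
  have h2 : (Complex.I * t) • hamiltonian Q z V = (t • generator Q z V)ᴴ := by
    rw [Matrix.conjTranspose_smul, generator_conjTranspose hQ, star_trivial, smul_neg, ← h1,
      neg_smul, neg_neg]
  rw [evolved, h1, h2, Matrix.exp_conjTranspose, Matrix.mul_vecMulVec, Matrix.vecMulVec_mul,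
    Matrix.star_mulVec]

theorem markedProb_evolved {Q : Matrix X X ℝ} {z : X → ℂ} {V : Matrix (X × X) (X × X) ℂ}
    (hQ : ∀ x y, 0 < Q x y → 0 < Q y x) (M : Finset X) (ψ : X × X → ℂ) (t : ℝ) :
    markedProb M (evolved (hamiltonian Q z V) ψ t) =
      ∑ a : X × X, if a.1 ∈ M then
        Complex.normSq ((NormedSpace.exp (t • generator Q z V) *ᵥ ψ) a) else 0 := by
  rw [markedProb_eq, evolved_hamiltonian hQ]
  refine Finset.sum_congr rfl fun a _ => ?_
  rw [Matrix.vecMulVec_apply, Pi.star_apply, RCLike.star_def, Complex.mul_conj, Complex.ofReal_re]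

/-- A continuous lower bound on the success probability at each time averages to a lower bound
for the random time. -/
theorem le_markedProb_averaged {Q : Matrix X X ℝ} {z : X → ℂ} {V : Matrix (X × X) (X × X) ℂ}
    (hQ : ∀ x y, 0 < Q x y → 0 < Q y x) (M : Finset X) (ψ : X × X → ℂ) {T : ℝ} (hT : 0 < T)
    {f : ℝ → ℝ} (hf : Continuous f)
    (hle : ∀ t, f t ≤ markedProb M (evolved (hamiltonian Q z V) ψ t)) :
    1 / T * ∫ t in (0 : ℝ)..T, f t ≤ markedProb M (averaged (hamiltonian Q z V) ψ T) := by
  have hcont : ∀ a b, Continuous fun t : ℝ => evolved (hamiltonian Q z V) ψ t a b := by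
    intro a b
    simp_rw [evolved_hamiltonian hQ]
    have h1 : Continuous fun t : ℝ => NormedSpace.exp (t • generator Q z V) *ᵥ ψ :=
      (continuous_exp_smul (generator Q z V)).matrix_mulVec continuous_const
    exact (h1.matrix_vecMulVec h1.star).matrix_elem a b
  have hre : ∀ a, Continuous fun t : ℝ => (evolved (hamiltonian Q z V) ψ t a a).re :=
    fun a => Complex.continuous_re.comp (hcont a a)
  have hcont2 : ∀ a : X × X, Continuous fun t : ℝ =>
      if a.1 ∈ M then (evolved (hamiltonian Q z V) ψ t a a).re else 0 := by
    intro a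
    split_ifs
    · exact hre a
    · exact continuous_const
  have havg : markedProb M (averaged (hamiltonian Q z V) ψ T) =
      1 / T * ∫ t in (0 : ℝ)..T, markedProb M (evolved (hamiltonian Q z V) ψ t) := by
    simp_rw [markedProb_eq]
    rw [intervalIntegral.integral_finsetSum fun a _ => (hcont2 a).intervalIntegrable _ _,
      Finset.mul_sum]
    refine Finset.sum_congr rfl fun a _ => ?_
    split_ifs
    · have h1 : ∫ t in (0 : ℝ)..T, (evolved (hamiltonian Q z V) ψ t a a).re =
          (∫ t in (0 : ℝ)..T, evolved (hamiltonian Q z V) ψ t a a).re := by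
        have := Complex.reCLM.intervalIntegral_comp_comm
          ((hcont a a).intervalIntegrable (μ := MeasureTheory.volume) 0 T)
        exact this
      rw [h1, averaged, Matrix.of_apply,
        show (1 / (T : ℂ)) = ((1 / T : ℝ) : ℂ) by push_cast; rfl, Complex.re_ofReal_mul]
    · simp
  rw [havg]
  refine mul_le_mul_of_nonneg_left ?_ (by positivity)
  refine intervalIntegral.integral_mono_on hT.le (hf.intervalIntegrable _ _) ?_ fun t _ => hle t
  simp_rw [markedProb_eq]
  exact (continuous_finsetSum _ fun a _ => hcont2 a).intervalIntegrable _ _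

/-! ### Spectral bounds for the discriminant matrix -/

/-- The Schur test for a symmetric matrix with nonnegative entries and a positive test vector. -/
theorem abs_dotProduct_mulVec_le {X : Type*} [Fintype X] {A : Matrix X X ℝ}
    (hA : ∀ x y, A x y = A y x) (hA0 : ∀ x y, 0 ≤ A x y) {ρ : X → ℝ} (hρ : ∀ x, 0 < ρ x)
    (v : X → ℝ) :
    |v ⬝ᵥ (A *ᵥ v)| ≤ ∑ x, v x ^ 2 * ((A *ᵥ ρ) x / ρ x) := by
  have hterm : ∀ x y, |v x * (A x y * v y)| ≤
      (A x y * ρ y / ρ x * v x ^ 2 + A y x * ρ x / ρ y * v y ^ 2) / 2 := by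
    intro x y
    have hx := hρ x
    have hy := hρ y
    have h1 : |v x * v y| ≤ (ρ y / ρ x * v x ^ 2 + ρ x / ρ y * v y ^ 2) / 2 := by
      have e : (ρ y / ρ x * v x ^ 2 + ρ x / ρ y * v y ^ 2) / 2 - |v x * v y| =
          (ρ y * |v x| - ρ x * |v y|) ^ 2 / (2 * (ρ x * ρ y)) := by
        rw [abs_mul, ← sq_abs (v x), ← sq_abs (v y)]
        field_simp
        ring
      have : 0 ≤ (ρ y * |v x| - ρ x * |v y|) ^ 2 / (2 * (ρ x * ρ y)) := by positivity
      linarith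
    rw [show v x * (A x y * v y) = A x y * (v x * v y) by ring, abs_mul, abs_of_nonneg (hA0 x y),
      hA y x]
    refine (mul_le_mul_of_nonneg_left h1 (hA0 x y)).trans_eq ?_
    ring
  have e1 : v ⬝ᵥ (A *ᵥ v) = ∑ x, ∑ y, v x * (A x y * v y) := by
    simp only [dotProduct, Matrix.mulVec, Finset.mul_sum]
  have e2 : ∑ x, v x ^ 2 * ((A *ᵥ ρ) x / ρ x) = ∑ x, ∑ y, A x y * ρ y / ρ x * v x ^ 2 := by
    refine Finset.sum_congr rfl fun x _ => ?_
    rw [Matrix.mulVec, dotProduct, Finset.sum_div, Finset.mul_sum]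
    exact Finset.sum_congr rfl fun y _ => by ring
  have e3 : ∑ x, ∑ y, A y x * ρ x / ρ y * v y ^ 2 = ∑ x, ∑ y, A x y * ρ y / ρ x * v x ^ 2 :=
    Finset.sum_comm
  rw [e1, e2]
  calc |∑ x, ∑ y, v x * (A x y * v y)| ≤ ∑ x, ∑ y, |v x * (A x y * v y)| :=
        (Finset.abs_sum_le_sum_abs _ _).trans
          (Finset.sum_le_sum fun x _ => Finset.abs_sum_le_sum_abs _ _)
    _ ≤ ∑ x, ∑ y, (A x y * ρ y / ρ x * v x ^ 2 + A y x * ρ x / ρ y * v y ^ 2) / 2 :=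
        Finset.sum_le_sum fun x _ => Finset.sum_le_sum fun y _ => hterm x y
    _ = ∑ x, ∑ y, A x y * ρ y / ρ x * v x ^ 2 := by
        simp_rw [← Finset.sum_div, Finset.sum_add_distrib]
        rw [e3]
        ring

section Interp

variable {P : Matrix X X ℝ} {π : X → ℝ} {M : Finset X} {s : ℝ}

theorem discriminant_interp_mulVec_sqrt (hP : P ∈ Matrix.rowStochastic ℝ X)
    (hpos : ∀ x, 0 < π x) (hrev : IsReversible P π) (h0 : 0 ≤ s) (h1 : s < 1) :
    discriminant (interp P M s) *ᵥ (fun x => √(interpWeight π M s x)) =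
      fun x => √(interpWeight π M s x) := by
  have h := discriminant_mulVec_sqrt (interpWeight_pos hpos M h1) (interp_nonneg hP.1 M h0 h1)
    (interp_reversible hrev M s) 1
  rw [interp_mulVec_one hP.2] at h
  simpa using h

/-- The self-loops of `P(s)` on the marked nodes keep its spectrum away from `-1` there:
`1 + D(P(s)) ≥ 2 s Π_M`, and `1 - D(P(s)) ≥ 0`. -/
theorem discriminant_interp_bounds (hP : P ∈ Matrix.rowStochastic ℝ X)
    (hpos : ∀ x, 0 < π x) (hrev : IsReversible P π) (h0 : 0 ≤ s) (h1 : s < 1) (v : X → ℝ) :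
    v ⬝ᵥ (discriminant (interp P M s) *ᵥ v) ≤ v ⬝ᵥ v ∧
      2 * s * ∑ x ∈ M, v x ^ 2 ≤ v ⬝ᵥ v + v ⬝ᵥ (discriminant (interp P M s) *ᵥ v) := by
  set ρ : X → ℝ := fun x => √(interpWeight π M s x) with hρdef
  have hρ : ∀ x, 0 < ρ x := fun x => Real.sqrt_pos.2 (interpWeight_pos hpos M h1 x)
  set δ : X → ℝ := fun x => if x ∈ M then s else 0 with hδ
  -- the Schur test is applied to what is left of `D(P(s))` without these self-loops
  set A := discriminant (interp P M s) - Matrix.diagonal δ with hA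
  have hsymm : ∀ x y, A x y = A y x := by
    intro x y
    simp only [hA, Matrix.sub_apply, discriminant, Matrix.of_apply,
      mul_comm (interp P M s x y) (interp P M s y x), Matrix.diagonal_apply]
    by_cases hxy : x = y
    · rw [hxy]
    · rw [if_neg hxy, if_neg (Ne.symm hxy)]
  have hnonneg : ∀ x y, 0 ≤ A x y := by
    intro x y
    simp only [hA, Matrix.sub_apply, discriminant, Matrix.of_apply, Matrix.diagonal_apply, hδ]
    by_cases hxy : x = y
    · subst hxy
      rw [if_pos rfl, Real.sqrt_mul_self (interp_nonneg hP.1 M h0 h1 x x), interp_apply,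
        if_pos rfl]
      have := hP.1 x x
      have h2 : 0 ≤ (1 - s) * P x x := mul_nonneg (by linarith) this
      split_ifs <;> linarith
    · rw [if_neg hxy, sub_zero]
      exact Real.sqrt_nonneg _
  have h := abs_dotProduct_mulVec_le hsymm hnonneg hρ v
  have hAρ : ∀ x, (A *ᵥ ρ) x / ρ x = 1 - δ x := by
    intro x
    rw [hA, Matrix.sub_mulVec, discriminant_interp_mulVec_sqrt hP hpos hrev h0 h1, Pi.sub_apply,
      Matrix.mulVec_diagonal]
    have := (hρ x).ne'
    change (ρ x - δ x * ρ x) / ρ x = 1 - δ x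
    field_simp
  have hsum : ∑ x, v x ^ 2 * δ x = s * ∑ x ∈ M, v x ^ 2 := by
    simp_rw [hδ, mul_ite, mul_zero]
    rw [Finset.sum_ite_mem, Finset.univ_inter, Finset.mul_sum]
    exact Finset.sum_congr rfl fun x _ => mul_comm _ _
  have e1 : ∑ x, v x ^ 2 * ((A *ᵥ ρ) x / ρ x) = v ⬝ᵥ v - s * ∑ x ∈ M, v x ^ 2 := by
    simp_rw [hAρ, mul_sub, Finset.sum_sub_distrib, hsum, mul_one, dotProduct, pow_two]
  have e2 : v ⬝ᵥ (A *ᵥ v) =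
      v ⬝ᵥ (discriminant (interp P M s) *ᵥ v) - s * ∑ x ∈ M, v x ^ 2 := by
    rw [hA, Matrix.sub_mulVec, dotProduct_sub, ← hsum]
    congr 1
    rw [dotProduct]
    exact Finset.sum_congr rfl fun x _ => by rw [Matrix.mulVec_diagonal]; ring
  rw [e1, e2, abs_le] at h
  constructor <;> linarith [h.1, h.2]

theorem IsErgodicChain.eq_smul_of_discriminant_interp_fixed (hP : IsErgodicChain P)
    (hpos : ∀ x, 0 < π x) (hrev : IsReversible P π) (h0 : 0 ≤ s) (h1 : s < 1) {φ : X → ℝ}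
    (hφ : discriminant (interp P M s) *ᵥ φ = φ) :
    ∃ c : ℝ, φ = fun x => c * √(interpWeight π M s x) := by
  set ρ : X → ℝ := fun x => √(interpWeight π M s x) with hρdef
  have hρ : ∀ x, ρ x ≠ 0 := fun x => (Real.sqrt_pos.2 (interpWeight_pos hpos M h1 x)).ne'
  set f : X → ℝ := fun x => φ x / ρ x with hf
  have hφf : φ = fun x => ρ x * f x := by
    ext x
    have := hρ x
    simp only [hf]
    field_simp
  have h := discriminant_mulVec_sqrt (interpWeight_pos hpos M h1)
    (interp_nonneg hP.stochastic.1 M h0 h1) (interp_reversible hrev M s) f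
  have hQf : ∀ x, (interp P M s *ᵥ f) x = f x := by
    intro x
    have h2 : (discriminant (interp P M s) *ᵥ fun x => ρ x * f x) x =
      ρ x * (interp P M s *ᵥ f) x := congrFun h x
    rw [← hφf, hφ, hφf] at h2
    exact (mul_left_cancel₀ (hρ x) h2).symm
  have hPf : P *ᵥ f = f := by
    ext x
    have h2 := hQf x
    rw [interp_mulVec] at h2
    split_ifs at h2
    · have h3 : (1 - s) * ((P *ᵥ f) x - f x) = 0 := by linarith
      have h4 := (mul_eq_zero.1 h3).resolve_left (by linarith)
      linarith
    · exact h2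
  rcases isEmpty_or_nonempty X with hX | ⟨⟨y⟩⟩
  · exact ⟨0, Subsingleton.elim _ _⟩
  · refine ⟨f y, ?_⟩
    rw [hφf]
    ext x
    rw [hP.harmonic_const hPf x y, mul_comm]

/-- A consequence of `1 + D(P(s)) ≥ 2 s Π_M` for the inverse of `1 + D(P(s))` at a unit vector
supported on the marked nodes. -/
theorem sum_sq_div_one_add_le (hP : P ∈ Matrix.rowStochastic ℝ X)
    (hpos : ∀ x, 0 < π x) (hrev : IsReversible P π) (h0 : 0 < s) (h1 : s < 1) {m : X → ℝ}
    (hm : ∀ x ∉ M, m x = 0) (hm1 : m ⬝ᵥ m = 1) :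
    ∑ j, (((discriminant_isHermitian (interp P M s)).eigenvectorBasis j).ofLp ⬝ᵥ m) ^ 2 /
      (1 + (discriminant_isHermitian (interp P M s)).eigenvalues j) ≤ 1 / (2 * s) := by
  set hA := discriminant_isHermitian (interp P M s)
  set c : X → ℝ := fun j => ((hA.eigenvectorBasis j).ofLp ⬝ᵥ m) with hc
  set l := hA.eigenvalues with hl
  set q := ∑ j, c j ^ 2 / (1 + l j) with hq
  change q ≤ _
  set y : X → ℝ :=
    (hA.eigenvectorBasis.repr.symm (WithLp.toLp 2 fun j => c j / (1 + l j))).ofLp with hy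
  have hey : ∀ j, (hA.eigenvectorBasis j).ofLp ⬝ᵥ y = c j / (1 + l j) := by
    intro j
    rw [hy, ← inner_eq_dotProduct, ← OrthonormalBasis.repr_apply_apply,
      LinearIsometryEquiv.apply_symm_apply]
  have hmy : m ⬝ᵥ y = q := by
    rw [← sum_eigenvectorBasis_mul hA]
    refine Finset.sum_congr rfl fun j _ => ?_
    rw [hey]
    ring
  have hyy : y ⬝ᵥ y + y ⬝ᵥ (discriminant (interp P M s) *ᵥ y) = q := by
    rw [← dotProduct_add, ← sum_eigenvectorBasis_mul hA]
    refine Finset.sum_congr rfl fun j _ => ?_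
    rw [dotProduct_add, eigenvectorBasis_dotProduct_mulVec, hey]
    by_cases hj : 1 + l j = 0
    · rw [hj]
      simp
    · change c j / (1 + l j) * (c j / (1 + l j) + l j * (c j / (1 + l j))) = _
      field_simp
  have hb := (discriminant_interp_bounds (M := M) hP hpos hrev h0.le h1 y).2
  rw [hyy] at hb
  have hcs : q ^ 2 ≤ ∑ x ∈ M, y x ^ 2 := by
    have e1 : m ⬝ᵥ y = ∑ x ∈ M, m x * y x :=
      (Finset.sum_subset (Finset.subset_univ M) fun x _ hx => by rw [hm x hx, zero_mul]).symm
    have e2 : ∑ x ∈ M, m x ^ 2 = 1 := by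
      rw [← hm1, dotProduct]
      refine (Finset.sum_subset (Finset.subset_univ M) fun x _ hx => ?_).trans
        (Finset.sum_congr rfl fun x _ => pow_two _)
      rw [hm x hx]
      ring
    rw [← hmy, e1]
    refine (Finset.sum_mul_sq_le_sq_mul_sq M m y).trans_eq ?_
    rw [e2, one_mul]
  rw [le_div_iff₀ (by positivity)]
  by_contra! hcon
  have hq0 : 0 < q := by
    by_contra! hq0
    nlinarith
  have h2 : 2 * s * q ^ 2 ≤ q := (mul_le_mul_of_nonneg_left hcs (by positivity)).trans hb
  nlinarith

end Interp

/-! ### Time averages -/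

theorem integral_cos_le {ω : ℝ} (hω : 0 < ω) (T : ℝ) :
    ∫ t in (0 : ℝ)..T, Real.cos (ω * t) ≤ 1 / ω := by
  rw [intervalIntegral.integral_comp_mul_left _ hω.ne', integral_cos, mul_zero, Real.sin_zero,
    sub_zero, smul_eq_mul, inv_mul_eq_div]
  exact div_le_div_of_nonneg_right (Real.sin_le_one _) hω.le

theorem integral_sum_cos_le {ι : Type*} [Fintype ι] {d l : ι → ℝ} (hl : ∀ j, l j ^ 2 ≤ 1)
    (hd : ∀ j, l j ^ 2 = 1 → d j = 0) (T : ℝ) :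
    ∫ t in (0 : ℝ)..T, ∑ j, d j ^ 2 * Real.cos (√(1 - l j ^ 2) * t) ≤
      √(∑ j, d j ^ 2 / (1 - l j)) * √(∑ j, d j ^ 2 / (1 + l j)) := by
  rw [intervalIntegral.integral_finsetSum fun j _ =>
    (Continuous.intervalIntegrable (by fun_prop) _ _)]
  have hl1 : ∀ j, 0 ≤ 1 - l j ∧ 0 ≤ 1 + l j := fun j => by
    have := abs_le.1 ((sq_le_one_iff_abs_le_one _).1 (hl j))
    constructor <;> linarith [this.1, this.2]
  have hterm : ∀ j, ∫ t in (0 : ℝ)..T, d j ^ 2 * Real.cos (√(1 - l j ^ 2) * t) ≤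
      √(d j ^ 2 / (1 - l j)) * √(d j ^ 2 / (1 + l j)) := by
    intro j
    by_cases h : l j ^ 2 = 1
    · simp [hd j h]
    · have hpos : 0 < 1 - l j ^ 2 := sub_pos.2 (lt_of_le_of_ne (hl j) h)
      have e : √(d j ^ 2 / (1 - l j)) * √(d j ^ 2 / (1 + l j)) =
          d j ^ 2 * (1 / √(1 - l j ^ 2)) := by
        rw [← Real.sqrt_mul (div_nonneg (sq_nonneg _) (hl1 j).1),
          show d j ^ 2 / (1 - l j) * (d j ^ 2 / (1 + l j)) = (d j ^ 2) ^ 2 / (1 - l j ^ 2) by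
            rw [div_mul_div_comm]; ring,
          Real.sqrt_div (sq_nonneg _), Real.sqrt_sq (sq_nonneg _)]
        ring
      rw [intervalIntegral.integral_const_mul, e]
      exact mul_le_mul_of_nonneg_left (integral_cos_le (Real.sqrt_pos.2 hpos) T) (sq_nonneg _)
  refine (Finset.sum_le_sum fun j _ => hterm j).trans ?_
  exact Real.sum_sqrt_mul_sqrt_le _ (fun j => div_nonneg (sq_nonneg _) (hl1 j).1)
    (fun j => div_nonneg (sq_nonneg _) (hl1 j).2)

/-! ### The success probability at a fixed time -/

section Success

variable {Q : Matrix X X ℝ} {z : X → ℂ} {V : Matrix (X × X) (X × X) ℂ}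

theorem re_star_tensor_dotProduct_exp_mulVec (hQ : ∀ x y, 0 < Q x y → 0 < Q y x)
    (hQ0 : ∀ x y, 0 ≤ Q x y) (hz : star z ⬝ᵥ z = 1) (hV : IsWalkUnitary Q z V)
    (hl : ∀ j, (discriminant_isHermitian Q).eigenvalues j ^ 2 ≤ 1) (χ u : X → ℝ) (t : ℝ) :
    (star (tensor (fun x => (χ x : ℂ)) z) ⬝ᵥ (NormedSpace.exp (t • generator Q z V) *ᵥ
      tensor (fun x => (u x : ℂ)) z)).re =
      ∑ j, (((discriminant_isHermitian Q).eigenvectorBasis j).ofLp ⬝ᵥ χ) *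
        (((discriminant_isHermitian Q).eigenvectorBasis j).ofLp ⬝ᵥ u) *
        Real.cos (√(1 - (discriminant_isHermitian Q).eigenvalues j ^ 2) * t) := by
  set hA := discriminant_isHermitian Q
  have hu : tensor (fun x => (u x : ℂ)) z = ∑ j, (((hA.eigenvectorBasis j).ofLp ⬝ᵥ u : ℝ) : ℂ) •
      tensor (fun x => (((hA.eigenvectorBasis j).ofLp x : ℝ) : ℂ)) z := by
    ext a
    have h := congrArg Complex.ofReal (congrFun (sum_eigenvectorBasis_smul hA u) a.1)
    simp only [Finset.sum_apply, Pi.smul_apply, smul_eq_mul, Complex.ofReal_sum,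
      Complex.ofReal_mul] at h
    simp only [tensor, Finset.sum_apply, Pi.smul_apply, smul_eq_mul, ← mul_assoc]
    rw [← Finset.sum_mul, h]
  rw [hu, Matrix.mulVec_sum, dotProduct_sum, Complex.re_sum]
  refine Finset.sum_congr rfl fun j _ => ?_
  have hχ : (star (fun x => (χ x : ℂ)) ⬝ᵥ fun x => (((hA.eigenvectorBasis j).ofLp x : ℝ) : ℂ)) =
      (((hA.eigenvectorBasis j).ofLp ⬝ᵥ χ : ℝ) : ℂ) := by
    simp [dotProduct, mul_comm]
  rw [Matrix.mulVec_smul, dotProduct_smul, star_tensor_dotProduct_exp_mulVec hQ hQ0 hz hV (hl j)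
    (hA.mulVec_eigenvectorBasis j), hχ, smul_eq_mul, ← Complex.ofReal_mul, ← Complex.ofReal_mul,
    Complex.ofReal_re]
  ring

/-- Split the initial state as `α v + β u`, where `v` is fixed by the evolution and the marked part
of `v` is `(v - u) / 2`. The cross term is then a return amplitude of `u`, and the square of the
`u`-part is dropped. -/
theorem le_markedProb_evolved (hQ : ∀ x y, 0 < Q x y → 0 < Q y x)
    (hQ0 : ∀ x y, 0 ≤ Q x y) (hz : star z ⬝ᵥ z = 1) (hV : IsWalkUnitary Q z V)
    (hl : ∀ j, (discriminant_isHermitian Q).eigenvalues j ^ 2 ≤ 1) {π : X → ℝ} {M : Finset X}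
    {v u : X → ℝ} {α β : ℝ} (hv : discriminant Q *ᵥ v = v)
    (hπ : ∀ x, √(π x) = α * v x + β * u x)
    (hvM : ∀ x, (if x ∈ M then v x else 0) = (v x - u x) / 2)
    (hu : ∀ j, (discriminant_isHermitian Q).eigenvalues j = 1 →
      ((discriminant_isHermitian Q).eigenvectorBasis j).ofLp ⬝ᵥ u = 0) (t : ℝ) :
    α ^ 2 * ∑ x ∈ M, v x ^ 2 - α * β *
      ∑ j, (((discriminant_isHermitian Q).eigenvectorBasis j).ofLp ⬝ᵥ u) ^ 2 *
        Real.cos (√(1 - (discriminant_isHermitian Q).eigenvalues j ^ 2) * t) ≤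
      markedProb M (evolved (hamiltonian Q z V) (initialState π z) t) := by
  set hA := discriminant_isHermitian Q
  set E := NormedSpace.exp (t • generator Q z V)
  set ψv := tensor (fun x => (v x : ℂ)) z with hψv
  set η := E *ᵥ tensor (fun x => (u x : ℂ)) z with hη
  have hinit : initialState π z = (α : ℂ) • ψv + (β : ℂ) • tensor (fun x => (u x : ℂ)) z := by
    ext a
    simp only [initialState, tensor, hψv, Pi.add_apply, Pi.smul_apply, smul_eq_mul, hπ]
    push_cast
    ring
  have hE : E *ᵥ initialState π z = (α : ℂ) • ψv + (β : ℂ) • η := by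
    rw [hinit, Matrix.mulVec_add, Matrix.mulVec_smul, Matrix.mulVec_smul,
      exp_mulVec_tensor_of_fixed hQ hQ0 hz hV hv]
  have hpt : ∀ a, α ^ 2 * Complex.normSq (ψv a) + 2 * (α * β) * (star (ψv a) * η a).re ≤
      Complex.normSq ((E *ᵥ initialState π z) a) := by
    intro a
    rw [hE]
    have h0 := mul_nonneg (sq_nonneg β) (Complex.normSq_nonneg (η a))
    simp only [Complex.normSq_apply, Pi.add_apply, Pi.smul_apply, smul_eq_mul, Complex.add_re,
      Complex.add_im, Complex.mul_re, Complex.mul_im, Complex.ofReal_re, Complex.ofReal_im,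
      RCLike.star_def, Complex.conj_re, Complex.conj_im] at h0 ⊢
    linear_combination h0
  have hzn : ∑ y, Complex.normSq (z y) = 1 := by
    have h := congrArg Complex.re hz
    simpa [dotProduct, Complex.re_sum, Complex.normSq_apply] using h
  have hsq : ∑ a : X × X, (if a.1 ∈ M then Complex.normSq (ψv a) else 0) =
      ∑ x ∈ M, v x ^ 2 := by
    have hM : ∑ x ∈ M, v x ^ 2 = ∑ x, if x ∈ M then v x ^ 2 else 0 := by
      rw [Finset.sum_ite_mem, Finset.univ_inter]
    rw [Fintype.sum_prod_type, hM]
    refine Finset.sum_congr rfl fun x _ => ?_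
    split_ifs
    · simp only [hψv, tensor, Complex.normSq_mul, Complex.normSq_ofReal]
      rw [← Finset.mul_sum, hzn]
      ring
    · simp
  have hcross : ∑ a : X × X, (if a.1 ∈ M then (star (ψv a) * η a).re else 0) =
      -(∑ j, ((hA.eigenvectorBasis j).ofLp ⬝ᵥ u) ^ 2 *
        Real.cos (√(1 - hA.eigenvalues j ^ 2) * t)) / 2 := by
    have e1 : ∑ a : X × X, (if a.1 ∈ M then (star (ψv a) * η a).re else 0) =
        (star (tensor (fun x => (((v x - u x) / 2 : ℝ) : ℂ)) z) ⬝ᵥ η).re := by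
      rw [dotProduct, Complex.re_sum]
      refine Finset.sum_congr rfl fun a _ => ?_
      rw [Pi.star_apply, tensor, ← hvM]
      split_ifs
      · rfl
      · simp
    rw [e1, re_star_tensor_dotProduct_exp_mulVec hQ hQ0 hz hV hl (fun x => (v x - u x) / 2) u,
      ← Finset.sum_neg_distrib, Finset.sum_div]
    refine Finset.sum_congr rfl fun j _ => ?_
    have h1 : (hA.eigenvectorBasis j).ofLp ⬝ᵥ (fun x => (v x - u x) / 2) =
        ((hA.eigenvectorBasis j).ofLp ⬝ᵥ v - (hA.eigenvectorBasis j).ofLp ⬝ᵥ u) / 2 := by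
      rw [← dotProduct_sub, dotProduct, dotProduct, Finset.sum_div]
      exact Finset.sum_congr rfl fun x _ => by rw [Pi.sub_apply]; ring
    have h2 : ((hA.eigenvectorBasis j).ofLp ⬝ᵥ v) * ((hA.eigenvectorBasis j).ofLp ⬝ᵥ u) = 0 := by
      by_cases hj : hA.eigenvalues j = 1
      · rw [hu j hj, mul_zero]
      · have h3 := eigenvectorBasis_dotProduct_mulVec hA j v
        rw [hv] at h3
        have h4 : (1 - hA.eigenvalues j) * ((hA.eigenvectorBasis j).ofLp ⬝ᵥ v) = 0 := by linarith
        rw [(mul_eq_zero.1 h4).resolve_left (sub_ne_zero.2 (Ne.symm hj)), zero_mul]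
    rw [h1]
    linear_combination (Real.cos (√(1 - hA.eigenvalues j ^ 2) * t) / 2) * h2
  rw [markedProb_evolved hQ]
  calc _ = ∑ a : X × X, (if a.1 ∈ M then
        α ^ 2 * Complex.normSq (ψv a) + 2 * (α * β) * (star (ψv a) * η a).re else 0) := by
        rw [← hsq]
        have e : ∀ a : X × X, (if a.1 ∈ M then
            α ^ 2 * Complex.normSq (ψv a) + 2 * (α * β) * (star (ψv a) * η a).re else 0) =
            α ^ 2 * (if a.1 ∈ M then Complex.normSq (ψv a) else 0) +
            2 * (α * β) * (if a.1 ∈ M then (star (ψv a) * η a).re else 0) := by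
          intro a
          split_ifs <;> ring
        simp_rw [e, Finset.sum_add_distrib, ← Finset.mul_sum, hcross]
        ring
    _ ≤ _ := by
        refine Finset.sum_le_sum fun a _ => ?_
        split_ifs
        · exact hpt a
        · exact le_rfl

end Success

/-! ### The interpolated chain at `s*` -/

/-- At `s*` the marked and the unmarked nodes have equal stationary weight. With `v` the stationary
state of `P(s*)` and `u` the same vector with the sign of its marked amplitudes reversed, the
initial state is a combination of `v` and `u`, and `|U⟩` is `(v + u) / √2`. -/
theorem exists_balanced_states {π : X → ℝ} {M : Finset X} (hpos : ∀ x, 0 < π x)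
    (hsum : ∑ x, π x = 1) (hM0 : 0 < markedMass π M) (hM1 : markedMass π M < 1) :
    ∃ v u : X → ℝ, ∃ α β k : ℝ,
      0 < k ∧ (∀ x, √(interpWeight π M (sStar π M) x) = k * v x) ∧
      (∀ x, √(π x) = α * v x + β * u x) ∧
      (∀ x, (if x ∈ M then v x else 0) = (v x - u x) / 2) ∧
      (∀ x, √2 * (stateU π M).ofLp x = v x + u x) ∧
      ∑ x ∈ M, v x ^ 2 = 1 / 2 ∧ v ⬝ᵥ v = 1 ∧ u ⬝ᵥ u = 1 ∧ v ⬝ᵥ u = 0 ∧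
      1 / 2 ≤ α ^ 2 ∧ α * β = (1 - 2 * markedMass π M) / 2 := by
  set p := markedMass π M with hp
  have hq : 0 < 1 - p := by linarith
  have hp0 := Real.sqrt_pos.2 hM0
  have hq0 := Real.sqrt_pos.2 hq
  have h20 : 0 < √2 := by positivity
  have hpp : √p ^ 2 = p := Real.sq_sqrt hM0.le
  have hqq : √(1 - p) ^ 2 = 1 - p := Real.sq_sqrt hq.le
  have h22 : √2 ^ 2 = 2 := Real.sq_sqrt (by norm_num)
  have hππ : ∀ x, √(π x) ^ 2 = π x := fun x => Real.sq_sqrt (hpos x).le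
  set v : X → ℝ := fun x => if x ∈ M then √(π x) / (√2 * √p) else √(π x) / (√2 * √(1 - p))
    with hv
  set u : X → ℝ := fun x => if x ∈ M then -(√(π x) / (√2 * √p)) else √(π x) / (√2 * √(1 - p))
    with hu
  have hvM : ∑ x ∈ M, v x ^ 2 = 1 / 2 := by
    have h1 : ∀ x ∈ M, v x ^ 2 = π x * (1 / (2 * p)) := by
      intro x hx
      rw [hv]
      simp only [if_pos hx]
      rw [div_pow, mul_pow, hππ, h22, hpp]
      ring
    rw [Finset.sum_congr rfl h1, ← Finset.sum_mul]
    change p * _ = _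
    field_simp
  have hvv : v ⬝ᵥ v = 1 := by
    have h1 : ∀ x, v x * v x = π x * (if x ∈ M then 1 / (2 * p) else 1 / (2 * (1 - p))) := by
      intro x
      simp only [hv, ← pow_two]
      split_ifs
      · rw [div_pow, mul_pow, hππ, h22, hpp]; ring
      · rw [div_pow, mul_pow, hππ, h22, hqq]; ring
    rw [dotProduct, Finset.sum_congr rfl fun x _ => h1 x, sum_ite_mul_eq π M hsum, ← hp]
    field_simp
    ring
  have hvu : v ⬝ᵥ u = 0 := by
    have h1 : ∀ x, v x * u x = π x * (if x ∈ M then -(1 / (2 * p)) else 1 / (2 * (1 - p))) := by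
      intro x
      simp only [hv, hu]
      split_ifs
      · rw [mul_neg, ← pow_two, div_pow, mul_pow, hππ, h22, hpp]; ring
      · rw [← pow_two, div_pow, mul_pow, hππ, h22, hqq]; ring
    rw [dotProduct, Finset.sum_congr rfl fun x _ => h1 x, sum_ite_mul_eq π M hsum, ← hp]
    field_simp
    ring
  have huu : u ⬝ᵥ u = 1 := by
    rw [← hvv, dotProduct, dotProduct]
    refine Finset.sum_congr rfl fun x _ => ?_
    simp only [hv, hu]
    split_ifs <;> ring
  refine ⟨v, u, (√(1 - p) + √p) / √2, (√(1 - p) - √p) / √2, √2 * √p, by positivity,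
    fun x => ?_, fun x => ?_, fun x => ?_, fun x => ?_, hvM, hvv, huu, hvu, ?_, ?_⟩
  · simp only [interpWeight, hv]
    split_ifs
    · field_simp
    · rw [sStar, ← hp, sub_sub_cancel, Real.sqrt_mul (by positivity), Real.sqrt_div hM0.le]
      field_simp
  · simp only [hv, hu]
    split_ifs
    · field_simp
      rw [h22]
      ring
    · field_simp
      rw [h22]
      ring
  · simp only [hv, hu]
    split_ifs <;> ring
  · simp only [stateU, hv, hu, ← hp]
    split_ifs
    · ring
    · field_simp
      rw [h22]
      ring
  · rw [div_pow, h22, add_sq, hpp, hqq]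
    have : 0 < √(1 - p) * √p := by positivity
    linarith
  · rw [div_mul_div_comm, ← pow_two √2, h22]
    linear_combination hqq / 2 - hpp / 2

theorem sStar_mem {X : Type*} {π : X → ℝ} {M : Finset X} (hM0 : 0 < markedMass π M)
    (hM2 : markedMass π M ≤ 1 / 2) : 0 ≤ sStar π M ∧ sStar π M < 1 := by
  have hq : 0 < 1 - markedMass π M := by linarith
  have h1 : 0 < markedMass π M / (1 - markedMass π M) := div_pos hM0 hq
  have h2 : markedMass π M / (1 - markedMass π M) ≤ 1 := by
    rw [div_le_one hq]
    linarith
  unfold sStar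
  constructor <;> linarith

/-- The search algorithm, in terms of the hitting time of `P(s*)`. -/
theorem le_markedProb_averaged_sStar {P : Matrix X X ℝ} {π : X → ℝ} {M : Finset X}
    (hP : IsErgodicChain P) (hpos : ∀ x, 0 < π x) (hsum : ∑ x, π x = 1)
    (hrev : IsReversible P π) (hM0 : 0 < markedMass π M) (hM2 : markedMass π M ≤ 1 / 2)
    {z : X → ℂ} (hz : star z ⬝ᵥ z = 1) {V : Matrix (X × X) (X × X) ℂ}
    (hV : IsWalkUnitary (interp P M (sStar π M)) z V) :
    1 / 2 ≤ 2 * interpHittingTime P π M (sStar π M) ∧ ∀ T : ℝ, 0 < T →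
      1 / 4 - √(2 * interpHittingTime P π M (sStar π M)) / (2 * T) ≤
        markedProb M (averaged (hamiltonian (interp P M (sStar π M)) z V)
          (initialState π z) T) := by
  obtain ⟨v, u, α, β, k, hk, hkv, hαβ, hvM, hU, hvM2, hvv, huu, hvu, hα, hprod⟩ :=
    exists_balanced_states (M := M) hpos hsum hM0 (by linarith)
  obtain ⟨h0, h1⟩ := sStar_mem hM0 hM2
  set p := markedMass π M with hp
  have hsdef : sStar π M = 1 - p / (1 - p) := rfl
  set s := sStar π M with hs
  set Q := interp P M s with hQdef
  have hQ0 : ∀ x y, 0 ≤ Q x y := interp_nonneg hP.stochastic.1 M h0 h1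
  have hrpos := interpWeight_pos hpos M h1
  have hQ : ∀ x y, 0 < Q x y → 0 < Q y x := by
    intro x y hxy
    have h := interp_reversible hrev M s x y
    have h2 := mul_pos (hrpos x) hxy
    rw [h] at h2
    exact (pos_iff_pos_of_mul_pos h2).1 (hrpos y)
  set hA := discriminant_isHermitian Q with hAdef
  set e : X → X → ℝ := fun j => (hA.eigenvectorBasis j).ofLp with he
  set l := hA.eigenvalues with hl
  have heD : ∀ j w, e j ⬝ᵥ (discriminant Q *ᵥ w) = l j * (e j ⬝ᵥ w) :=
    eigenvectorBasis_dotProduct_mulVec hA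
  have hee : ∀ j, e j ⬝ᵥ e j = 1 := eigenvectorBasis_dotProduct_self hA
  have hv : discriminant Q *ᵥ v = v := by
    have h := discriminant_interp_mulVec_sqrt (M := M) hP.stochastic hpos hrev h0 h1
    have h2 : (fun x => √(interpWeight π M s x)) = k • v := funext hkv
    rw [h2, Matrix.mulVec_smul] at h
    exact smul_right_injective _ hk.ne' h
  have hbd : ∀ j, l j ≤ 1 ∧ 2 * s * ∑ x ∈ M, e j x ^ 2 ≤ 1 + l j := by
    intro j
    have h := discriminant_interp_bounds (M := M) hP.stochastic hpos hrev h0 h1 (e j)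
    rw [← hQdef, heD, hee, mul_one] at h
    exact h
  have hl1 : ∀ j, 0 ≤ 1 + l j := fun j =>
    (mul_nonneg (by positivity) (Finset.sum_nonneg fun x _ => sq_nonneg _)).trans (hbd j).2
  have hl2 : ∀ j, l j ^ 2 ≤ 1 := fun j => by
    rw [sq_le_one_iff_abs_le_one, abs_le]
    exact ⟨by linarith [hl1 j], (hbd j).1⟩
  have hva : ∀ j, l j ≠ 1 → e j ⬝ᵥ v = 0 := by
    intro j hj
    have h3 := heD j v
    rw [hv] at h3
    have h4 : (1 - l j) * (e j ⬝ᵥ v) = 0 := by linarith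
    exact (mul_eq_zero.1 h4).resolve_left (sub_ne_zero.2 (Ne.symm hj))
  -- the eigenvalue `1` is simple, and `u` is orthogonal to its eigenvector
  have hu1 : ∀ j, l j = 1 → e j ⬝ᵥ u = 0 := by
    intro j hj
    have hfix : discriminant Q *ᵥ e j = e j := by
      have h := hA.mulVec_eigenvectorBasis j
      rw [← hl, hj, one_smul] at h
      exact h
    obtain ⟨c, hc⟩ := hP.eq_smul_of_discriminant_interp_fixed hpos hrev h0 h1 hfix
    have h2 : e j = (c * k) • v := by
      rw [hc]
      ext x
      rw [hkv, Pi.smul_apply, smul_eq_mul, mul_assoc]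
    rw [h2, smul_dotProduct, hvu, smul_zero]
  set d : X → ℝ := fun j => e j ⬝ᵥ u with hd
  set H := interpHittingTime P π M s with hHdef
  have hH : ∑ j, d j ^ 2 / (1 - l j) = 2 * H := by
    rw [hHdef, interpHittingTime, resolventSum, Finset.mul_sum, Finset.sum_filter]
    refine Finset.sum_congr rfl fun j _ => ?_
    change _ = if l j ≠ 1 then 2 * (inner ℝ (hA.eigenvectorBasis j) (stateU π M) ^ 2 / (1 - l j))
      else 0
    split_ifs with hj
    · have h2 : √2 * (e j ⬝ᵥ (stateU π M).ofLp) = d j := by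
        have h3 : √2 • (stateU π M).ofLp = v + u := funext hU
        rw [← smul_eq_mul, ← dotProduct_smul, h3, dotProduct_add, hva j hj, zero_add]
      rw [inner_eq_dotProduct, ← h2, mul_pow, Real.sq_sqrt (by norm_num)]
      ring
    · rw [hd]
      simp only
      rw [hu1 j (by simpa using hj)]
      simp
  have hdsum : ∑ j, d j ^ 2 = 1 := by
    rw [← huu, ← sum_eigenvectorBasis_mul hA]
    exact Finset.sum_congr rfl fun j _ => pow_two _
  refine ⟨?_, fun T hT => ?_⟩
  · rw [hH.symm, show (1 / 2 : ℝ) = ∑ j, d j ^ 2 / 2 by rw [← Finset.sum_div, hdsum]]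
    refine Finset.sum_le_sum fun j _ => ?_
    by_cases hj : l j = 1
    · simp [hd, hu1 j hj]
    · have h2 : 0 < 1 - l j := sub_pos.2 (lt_of_le_of_ne (hbd j).1 hj)
      exact div_le_div_of_nonneg_left (sq_nonneg _) h2 (by linarith [hl1 j])
  set F : ℝ → ℝ := fun t => ∑ j, d j ^ 2 * Real.cos (√(1 - l j ^ 2) * t) with hF
  have hFc : Continuous F := by
    rw [hF]
    fun_prop
  have hle := le_markedProb_averaged (z := z) (V := V) hQ M (initialState π z) hT
    (f := fun t => α ^ 2 * (1 / 2) - α * β * F t) (by fun_prop) fun t => by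
      have h := le_markedProb_evolved hQ hQ0 hz hV hl2 hv hαβ hvM hu1 t
      rw [hvM2] at h
      exact h
  refine le_trans ?_ hle
  have hint : ∫ t in (0 : ℝ)..T, (α ^ 2 * (1 / 2) - α * β * F t) =
      T * (α ^ 2 * (1 / 2)) - α * β * ∫ t in (0 : ℝ)..T, F t := by
    rw [intervalIntegral.integral_sub intervalIntegrable_const
      ((hFc.const_mul _).intervalIntegrable _ _), intervalIntegral.integral_const,
      intervalIntegral.integral_const_mul, sub_zero, smul_eq_mul]
  have hq : 0 < 1 - p := by linarith
  have hαs : α * β = s * (1 - p) / 2 := by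
    rw [hprod, hsdef]
    field_simp
    ring
  -- the frequency `√(1 - l²)` is also small near `l = -1`; the overlap of `u` is small there too
  have hmain : α * β * ∫ t in (0 : ℝ)..T, F t ≤ √(2 * H) / 2 := by
    rcases h0.eq_or_lt with hs0 | hs0
    · rw [hαs, ← hs0]
      simp only [zero_mul, zero_div]
      positivity
    set m : X → ℝ := (√2)⁻¹ • (u - v) with hm
    have hmM : ∀ x ∉ M, m x = 0 := by
      intro x hx
      have h := hvM x
      rw [if_neg hx] at h
      rw [hm, Pi.smul_apply, Pi.sub_apply, show u x - v x = 0 by linarith, smul_zero]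
    have hmm : m ⬝ᵥ m = 1 := by
      have h2 : √2 * √2 = 2 := Real.mul_self_sqrt (by norm_num)
      rw [hm, smul_dotProduct, dotProduct_smul, sub_dotProduct, dotProduct_sub, dotProduct_sub,
        huu, hvv, hvu, dotProduct_comm u v, hvu, smul_eq_mul, smul_eq_mul, ← mul_assoc,
        ← mul_inv, h2]
      norm_num
    have hdm : ∀ j, l j ≠ 1 → d j ^ 2 = 2 * (e j ⬝ᵥ m) ^ 2 := by
      intro j hj
      rw [hm, dotProduct_smul, dotProduct_sub, hva j hj, sub_zero, smul_eq_mul, mul_pow, inv_pow,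
        Real.sq_sqrt (by norm_num)]
      ring
    have hd0 : ∀ j, l j ^ 2 = 1 → d j = 0 := by
      intro j hj
      rcases mul_self_eq_one_iff.1 ((pow_two _).symm.trans hj) with h | h
      · exact hu1 j h
      · have h2 := (hbd j).2
        rw [h, add_neg_cancel] at h2
        have h3 : ∑ x ∈ M, e j x ^ 2 = 0 :=
          le_antisymm (nonpos_of_mul_nonpos_right h2 (by positivity))
            (Finset.sum_nonneg fun x _ => sq_nonneg _)
        have h4 := (Finset.sum_eq_zero_iff_of_nonneg fun x _ => sq_nonneg (e j x)).1 h3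
        have h5 : e j ⬝ᵥ m = 0 := by
          refine Finset.sum_eq_zero fun x _ => ?_
          by_cases hx : x ∈ M
          · rw [pow_eq_zero_iff two_ne_zero |>.1 (h4 x hx), zero_mul]
          · rw [hmM x hx, mul_zero]
        have h6 := hdm j (by rw [h]; norm_num)
        rw [h5] at h6
        simpa using h6
    have hplus : ∑ j, d j ^ 2 / (1 + l j) ≤ 1 / s := by
      have h2 := sum_sq_div_one_add_le hP.stochastic hpos hrev hs0 h1 hmM hmm
      have h3 : ∑ j, d j ^ 2 / (1 + l j) ≤ 2 * ∑ j, (e j ⬝ᵥ m) ^ 2 / (1 + l j) := by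
        rw [Finset.mul_sum]
        refine Finset.sum_le_sum fun j _ => ?_
        by_cases hj : l j = 1
        · rw [hd]
          simp only
          rw [hu1 j hj, hj, zero_pow two_ne_zero, zero_div]
          positivity
        · rw [hdm j hj, mul_div_assoc]
      refine (h3.trans (mul_le_mul_of_nonneg_left h2 zero_le_two)).trans_eq ?_
      field_simp
    have hFint := integral_sum_cos_le hl2 hd0 T
    rw [hH] at hFint
    have h4 : ∫ t in (0 : ℝ)..T, F t ≤ √(2 * H) * √(1 / s) :=
      hFint.trans (mul_le_mul_of_nonneg_left (Real.sqrt_le_sqrt hplus) (Real.sqrt_nonneg _))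
    have h5 : s * √(1 / s) ≤ 1 := by
      rw [Real.sqrt_div zero_le_one, Real.sqrt_one, mul_one_div, Real.div_sqrt]
      exact Real.sqrt_le_one.2 h1.le
    have h6 : s * (1 - p) * √(1 / s) ≤ 1 := by
      have : 0 ≤ s * √(1 / s) := by positivity
      nlinarith
    calc α * β * ∫ t in (0 : ℝ)..T, F t ≤ α * β * (√(2 * H) * √(1 / s)) := by
          refine mul_le_mul_of_nonneg_left h4 ?_
          rw [hαs]
          positivity
      _ = √(2 * H) / 2 * (s * (1 - p) * √(1 / s)) := by rw [hαs]; ring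
      _ ≤ √(2 * H) / 2 * 1 := mul_le_mul_of_nonneg_left h6 (by positivity)
      _ = √(2 * H) / 2 := mul_one _
  rw [hint, mul_sub, ← mul_assoc, one_div_mul_cancel hT.ne', one_mul]
  have h7 : 1 / T * (α * β * ∫ t in (0 : ℝ)..T, F t) ≤ √(2 * H) / (2 * T) := by
    refine (mul_le_mul_of_nonneg_left hmain (by positivity)).trans_eq ?_
    field_simp
  linarith

end QSearch

end

theorem theorem2 {X : Type*} [Fintype X] [DecidableEq X]
    (P : Matrix X X ℝ) (π : X → ℝ) (M : Finset X)
    (hP : QSearch.IsErgodicChain P) (hπ : QSearch.IsStationary P π)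
    (hrev : QSearch.IsReversible P π) (hM : M.Nonempty) (hM' : M ≠ Finset.univ) :
    -- the limit that defines the extended hitting time exists
    Filter.Tendsto (QSearch.interpHittingTime P π M) (𝓝[<] 1)
      (𝓝 (QSearch.extendedHittingTime P π M)) ∧
    -- for a single marked node it is the hitting time
    (M.card = 1 → QSearch.extendedHittingTime P π M = QSearch.hittingTime P π M) ∧
    -- the search algorithm; `p_M ≤ 1/2` says that `s*` lies in `[0, 1)`
    (QSearch.markedMass π M ≤ 1 / 2 →
      ∀ (z : X → ℂ), star z ⬝ᵥ z = 1 →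
      ∀ (V : Matrix (X × X) (X × X) ℂ),
        QSearch.IsWalkUnitary (QSearch.interp P M (QSearch.sStar π M)) z V →
      ∀ (ε T : ℝ), 0 < ε →
        1 / ε * √(QSearch.extendedHittingTime P π M / 2) ≤ T →
        1 / 4 - ε ≤
          QSearch.markedProb M
            (QSearch.averaged
              (QSearch.hamiltonian (QSearch.interp P M (QSearch.sStar π M)) z V)
              (QSearch.initialState π z) T)) := by
  have hpos := QSearch.IsStationary.pos hP hπ
  have hsum := hπ.sum_eq_one
  have hM0 := QSearch.markedMass_pos hpos hM
  have hM1 := QSearch.markedMass_lt_one hpos hsum hM'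
  obtain ⟨g, hg⟩ := hP.exists_poisson hπ (QSearch.dotProduct_hitSource M hsum)
  have hlim := QSearch.tendsto_interpHittingTime hP.stochastic hpos hrev hM1 hM0 hg
  have hext : QSearch.extendedHittingTime P π M = _ := hlim.limUnder_eq
  refine ⟨by rw [hext]; exact hlim, fun hcard => ?_, ?_⟩
  · obtain ⟨x₀, rfl⟩ := Finset.card_eq_one.1 hcard
    -- solutions of Poisson's equation are determined up to a constant
    have hg' : (g - g x₀ • (1 : X → ℝ)) - P *ᵥ (g - g x₀ • (1 : X → ℝ)) =
        QSearch.hitSource π {x₀} := by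
      rw [Matrix.mulVec_sub, Matrix.mulVec_smul, hP.stochastic.2, ← hg]
      abel
    have hlim' := QSearch.tendsto_interpHittingTime hP.stochastic hpos hrev hM1 hM0 hg'
    rw [QSearch.hittingTime_eq hP.stochastic hpos hrev hM1 hM0 hg'
      (fun x hx => by simp [Finset.mem_singleton.1 hx])]
    exact hlim'.limUnder_eq
  · intro hM2 z hz V hV ε T hε hT
    obtain ⟨hhalf, hbound⟩ :=
      QSearch.le_markedProb_averaged_sStar hP hpos hsum hrev hM0 hM2 hz hV
    obtain ⟨h0, h1⟩ := QSearch.sStar_mem hM0 hM2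
    -- at `s*` the factor `(1 - s (1 - p))²` is `(2 p)²`
    have hfour : QSearch.extendedHittingTime P π M / 2 =
        2 * QSearch.interpHittingTime P π M (QSearch.sStar π M) := by
      have hq : 1 - QSearch.markedMass π M ≠ 0 := by linarith
      have hs : 1 - QSearch.sStar π M * (1 - QSearch.markedMass π M) =
          2 * QSearch.markedMass π M := by
        rw [QSearch.sStar]
        field_simp
        ring
      rw [hext, QSearch.interpHittingTime_eq hP.stochastic hpos hrev hM1 hM0 hg h0 h1, hs]
      field_simp
    rw [hfour] at hT
    set R := √(2 * QSearch.interpHittingTime P π M (QSearch.sStar π M)) with hR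
    have hRpos : 0 < R := Real.sqrt_pos.2 (by linarith)
    have hTpos : 0 < T := lt_of_lt_of_le (by positivity) hT
    have h2 : R ≤ ε * T := by
      rwa [one_div, inv_mul_le_iff₀ hε] at hT
    have h3 : R / (2 * T) ≤ ε / 2 := by
      rw [div_le_div_iff₀ (by positivity) two_pos]
      linarith
    linarith [hbound T hTpos]
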